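/- Let $\mathbf{T}^1=\mathbf{R}/\mathbf{Z}$. For an immersed closed $H^2$-curve $\gamma:\mathbf{T}^1\to\mathbf{R}^2$ with arclength parameter $s$ and curvature vector $\kappa=\partial_s^2\gamma$, let $L[\gamma]=\int_\gamma ds$, $B[\gamma]=\int_\gamma|\kappa|^2ds$ and $\bar B[\gamma]=L[\gamma]B[\gamma]$. A point $p$ is a point of multiplicity $k$ of $\gamma$ if $\gamma^{-1}(p)$ contains at least $k$ distinct points. For an integer $k\ge1$ let $C_k$ be the class of all immersed closed $H^2$-curves $\gamma:\mathbf{T}^1\to\mathbf{R}^2$ with a point of multiplicity $k$, and let $\beta_k=\inf_{\gamma\in C_k}\bar B[\gamma]$. Then for every integer $k\ge1$ there exists $\bar\gamma\in C_k$ such that $\bar B[\bar\gamma]=\beta_k$. In addition, the curve $\bar\gamma$ can be divided into $k$ open curves at a point of multiplicity $k$, each of which is an elastica with one and the same positive multiplier. That is, there are a point $p$ of multiplicity $k$ of $\bar\gamma$, real numbers $a_0<a_1<\dots<a_k=a_0+1$ with $\bar\gamma(a_i)=p$ for all $i$ (arguments taken mod $1$), and a number $\lambda>0$ such that, for each $i=1,\dots,k$,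 the restriction $\bar\gamma_i$ of $\bar\gamma$ to $[a_{i-1},a_i]$ is smooth up to the end points and satisfies $$2\nabla_s^2\kappa+|\kappa|^2\kappa-\lambda\kappa=0,$$ where $\nabla_s\psi=\partial_s\psi-\langle\partial_s\psi,T\rangle T$ is the normal derivative along $\bar\gamma_i$ and $T=\partial_s\bar\gamma_i$ is its unit tangent. -/

import Mathlib

open scoped ContDiff

noncomputable section

namespace ElasticCurve

variable {E : Type*} [NormedAddCommGroup E] [InnerProductSpace ℝ E]

/-- The arclength derivative `∂ₛψ = |∂ₜc|⁻¹ ∂ₜψ` of a field `ψ` along a curve `c` with parameter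
domain `S`. The domain is `Set.univ` for (lifts of) closed curves and `Set.Icc a b` for open
curves, in which case the derivatives at the end points are one-sided. -/
def arcDeriv (S : Set ℝ) (c ψ : ℝ → E) (t : ℝ) : E :=
  ‖derivWithin c S t‖⁻¹ • derivWithin ψ S t

/-- The unit tangent `T = ∂ₛc`. -/
def tangent (S : Set ℝ) (c : ℝ → E) : ℝ → E := arcDeriv S c c

/-- The curvature vector `κ = ∂ₛ²c`. -/
def curvature (S : Set ℝ) (c : ℝ → E) : ℝ → E := arcDeriv S c (tangent S c)

/-- The normal derivative `∇ₛψ = ∂ₛψ - ⟨∂ₛψ, T⟩ T` along the curve `c`. -/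
def normalDeriv (S : Set ℝ) (c ψ : ℝ → E) (t : ℝ) : E :=
  arcDeriv S c ψ t - inner ℝ (arcDeriv S c ψ t) (tangent S c t) • tangent S c t

/-- The open curve `c : [a, b] → E` is an elastica with multiplier `lam`: it is immersed, smooth up
to the end points, and solves `2 ∇ₛ²κ + |κ|² κ - lam κ = 0`. -/
structure IsElastica (c : ℝ → E) (a b lam : ℝ) : Prop where
  lt : a < b
  smooth : ContDiffOn ℝ ∞ c (Set.Icc a b)
  immersed : ∀ t ∈ Set.Icc a b, derivWithin c (Set.Icc a b) t ≠ 0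
  equation : ∀ t ∈ Set.Icc a b,
    (2 : ℝ) • normalDeriv (Set.Icc a b) c
        (normalDeriv (Set.Icc a b) c (curvature (Set.Icc a b) c)) t
      + ‖curvature (Set.Icc a b) c t‖ ^ 2 • curvature (Set.Icc a b) c t
      - lam • curvature (Set.Icc a b) c t = 0

/-- The `1`-periodic lift to `ℝ` of a closed curve `γ : ℝ/ℤ → E`. -/
def lift (γ : UnitAddCircle → E) (t : ℝ) : E := γ (t : UnitAddCircle)

/-- `γ ∈ H²(ℝ/ℤ; E)`, for the `C¹` representative: the first derivative is absolutely continuous and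
the second derivative, which then exists almost everywhere and is the weak one, is square
integrable over a period. -/
structure IsH2 (γ : UnitAddCircle → E) : Prop where
  contDiff : ContDiff ℝ 1 (lift γ)
  absCont : AbsolutelyContinuousOnInterval (deriv (lift γ)) 0 1
  memLp : MeasureTheory.MemLp (deriv (deriv (lift γ))) 2
    (MeasureTheory.volume.restrict (Set.Icc (0 : ℝ) 1))

/-- The closed curve `γ` is immersed. -/
def IsImmersed (γ : UnitAddCircle → E) : Prop := ∀ t : ℝ, deriv (lift γ) t ≠ 0

/-- `p` is a point of multiplicity `k` of `γ`: it has at least `k` distinct preimages. -/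
def HasMultiplicity (γ : UnitAddCircle → E) (p : E) (k : ℕ) : Prop :=
  (k : ℕ∞) ≤ (γ ⁻¹' {p}).encard

/-- The length `L[γ] = ∫_γ ds`. -/
def length (γ : UnitAddCircle → E) : ℝ := ∫ t in (0 : ℝ)..1, ‖deriv (lift γ) t‖

/-- The bending energy `B[γ] = ∫_γ |κ|² ds`. -/
def bending (γ : UnitAddCircle → E) : ℝ :=
  ∫ t in (0 : ℝ)..1, ‖curvature Set.univ (lift γ) t‖ ^ 2 * ‖deriv (lift γ) t‖

/-- The normalized bending energy `L[γ] B[γ]`. -/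
def normalizedBending (γ : UnitAddCircle → E) : ℝ := length γ * bending γ

/-- The class `C_k` of immersed closed planar `H²`-curves with a point of multiplicity `k`. -/
def curveClass (k : ℕ) : Set (UnitAddCircle → EuclideanSpace ℝ (Fin 2)) :=
  {γ | IsH2 γ ∧ IsImmersed γ ∧ ∃ p, HasMultiplicity γ p k}

/-- `β_k`, the infimum of the normalized bending energy over `C_k`. -/
def beta (k : ℕ) : ℝ := sInf (normalizedBending '' curveClass k)

end ElasticCurve

end

/-!
A closed curve with `k` preimages of a point splits there into `k` closed arcs. Up to similarity and
reparametrization an arc is determined by its curvature density `u ∈ L²(0, 1)` in normalized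
arclength: its angle is `angle u x = ∫₀ˣ u`, and it closes up iff `∫₀¹ (cos, sin)(angle u) = 0`, a
condition that is invariant under rotations. An arc of length `l` and bending energy `B` has
`‖u‖² = l B`, so for arcs `u 0, …, u (k - 1)` the Cauchy–Schwarz inequality gives
`(∑ l i) (∑ B i) ≥ (∑ ‖u i‖)²`, with equality iff all `l i` are proportional to `‖u i‖`. Hence `β_k`
is the square of the minimum of `∑ ‖u i‖` over all families of densities of closing arcs whose total
turning angles add up to a multiple of `2π`; the latter condition says that the arcs can be joined
with continuous tangent. The lower bound is `exists_admissible_of_mem_curveClass`.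

The minimum is attained (`exists_minimizer`): the constraints are weakly continuous because the
angle functions converge pointwise, and the norm is weakly lower semicontinuous.

In a minimizing family each `u i` minimizes its own norm for a given total turning angle. The
Lagrange multiplier rule in `L²` and the kernel `⟨1_(0,x], 1_(0,y]⟩ = min x y`, which is the Green
function of `-d²/dx²`, give `v' = ⟨ν, N⟩` for the curvature `v` of the arc, with a constant vector
`ν`. Its first integral is `v² - 2 ⟨ν, T⟩ = const`, and since `∫ T = 0` the constant is `‖u i‖²`.
So `2 v'' + v³ - ‖u i‖² v = 0` (`exists_euler_lagrange`). Rescaling to the optimal length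
`l i = ‖u i‖ / ∑ ‖u j‖` turns `‖u i‖²` into `‖u i‖² / (l i)² = (∑ ‖u j‖)²`, which is positive and
the same for all arcs (`exists_curve_of_minimizer`).
-/

noncomputable section

open MeasureTheory Set Filter Topology
open scoped ContDiff NNReal

namespace ElasticCurve

/-! ### Curvature densities of closed arcs -/

/-- The Hilbert space `L²(ℝ)` in which the curvature densities of the arcs live. The arcs are
parametrized over `[0, 1]`; values of a density outside this interval do not affect the arc and only
increase the norm. -/
abbrev L2Line : Type := Lp ℝ 2 (volume : Measure ℝ)

/-- The indicator function of `(0, x]` as an element of `L²(ℝ)`. Pairing a curvature density with it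
gives the turning angle at the parameter `x`. -/
def ker (x : ℝ) : L2Line :=
  indicatorConstLp 2 (measurableSet_Ioc : MeasurableSet (Ioc (0 : ℝ) x)) (by simp) (1 : ℝ)

/-- The turning angle `x ↦ ∫₀ˣ u` of an arc with curvature density `u`. -/
def angle (u : L2Line) (x : ℝ) : ℝ := inner ℝ (ker x) u

lemma angle_eq_setIntegral (u : L2Line) (x : ℝ) : angle u x = ∫ t in Ioc 0 x, u t := by
  unfold angle ker
  rw [L2.inner_indicatorConstLp_one]

lemma inner_ker_ker_eq_max (x y : ℝ) : inner ℝ (ker x) (ker y) = max (min x y) 0 := by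
  unfold ker
  rw [L2.real_inner_indicatorConstLp_one_indicatorConstLp_one _ _ (by simp) (by simp),
    Ioc_inter_Ioc, max_self, measureReal_def, Real.volume_Ioc, ENNReal.toReal_ofReal', sub_zero]

/-- On `[0, ∞)` the inner products of the indicator functions are the Green function of `-d²/dx²`
with boundary condition `0` at `0`. -/
lemma inner_ker_ker {x y : ℝ} (hx : 0 ≤ x) (hy : 0 ≤ y) :
    inner ℝ (ker x) (ker y) = min x y := by
  rw [inner_ker_ker_eq_max, max_eq_left (le_min hx hy)]

lemma ker_of_nonpos {x : ℝ} (hx : x ≤ 0) : ker x = 0 := by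
  rw [← inner_self_eq_zero (𝕜 := ℝ), inner_ker_ker_eq_max, min_self, max_eq_right hx]

lemma norm_ker_sub_sq {x y : ℝ} (hx : 0 ≤ x) (hy : 0 ≤ y) : ‖ker x - ker y‖ ^ 2 = |x - y| := by
  rw [@norm_sub_sq_real, ← real_inner_self_eq_norm_sq, ← real_inner_self_eq_norm_sq,
    inner_ker_ker hx hx, inner_ker_ker hy hy, inner_ker_ker hx hy]
  rcases le_total x y with h | h
  · rw [abs_of_nonpos (by linarith)]; simp [h]; ring
  · rw [abs_of_nonneg (by linarith)]; simp [h]; ring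

lemma continuous_ker : Continuous ker := by
  have h : ∀ x, ker x = ker (max x 0) := fun x => by
    rcases le_total x 0 with h | h
    · rw [max_eq_right h, ker_of_nonpos h, ker_of_nonpos le_rfl]
    · rw [max_eq_left h]
  rw [continuous_iff_continuousAt]
  intro y
  unfold ContinuousAt
  rw [tendsto_iff_norm_sub_tendsto_zero]
  have h2 : ∀ x, ‖ker x - ker y‖ = √|max x 0 - max y 0| := fun x => by
    rw [← norm_ker_sub_sq (le_max_right _ _) (le_max_right _ _), Real.sqrt_sq (norm_nonneg _),
      ← h x, ← h y]
  simp_rw [h2]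
  have : Continuous fun x : ℝ => √|max x 0 - max y 0| := by fun_prop
  simpa using this.tendsto y

lemma norm_ker_le_one {x : ℝ} (hx : x ∈ Icc (0 : ℝ) 1) : ‖ker x‖ ≤ 1 := by
  have h := inner_ker_ker hx.1 hx.1
  rw [real_inner_self_eq_norm_sq, min_self] at h
  have := hx.2
  nlinarith [norm_nonneg (ker x)]

@[simp] lemma angle_zero (u : L2Line) : angle u 0 = 0 := by
  simp [angle, ker_of_nonpos le_rfl]

@[fun_prop]
lemma continuous_angle (u : L2Line) : Continuous (angle u) :=
  continuous_ker.inner continuous_const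

@[fun_prop]
lemma continuous_angle_left (x : ℝ) : Continuous fun u : L2Line => angle u x :=
  continuous_const.inner continuous_id

/-- The arc with curvature density `u` on the parameter interval `[0, 1]` closes up:
`∫₀¹ (cos, sin)(angle u) = 0`. -/
def ClosesUp (u : L2Line) : Prop :=
  ∫ x in (0 : ℝ)..1, Real.cos (angle u x) = 0 ∧ ∫ x in (0 : ℝ)..1, Real.sin (angle u x) = 0

/-- The curvature densities `u 0, …, u (k - 1)` describe `k` arcs, each of which closes up, and
whose total turning angles add up to a multiple of `2π`, so that the arcs can be joined to a
closed curve with continuous tangent. The terms `u i` with `k ≤ i` play no role. -/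
structure Admissible (k : ℕ) (u : ℕ → L2Line) : Prop where
  closesUp : ∀ i < k, ClosesUp (u i)
  cos_turning : Real.cos (∑ i ∈ Finset.range k, angle (u i) 1) = 1

/-- The sum of the `L²` norms of the curvature densities of the `k` arcs. Its square is the
normalized bending energy after the lengths of the arcs have been chosen optimally. -/
def normSum (k : ℕ) (u : ℕ → L2Line) : ℝ := ∑ i ∈ Finset.range k, ‖u i‖

lemma normSum_nonneg (k : ℕ) (u : ℕ → L2Line) : 0 ≤ normSum k u :=
  Finset.sum_nonneg fun _ _ => norm_nonneg _

/-! ### Existence of minimizing curvature densities -/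

/-- Needed for the separability of `L²(ℝ)`. -/
instance : Fact ((2 : ENNReal) ≠ ⊤) := ⟨by simp⟩

/-- Weak sequential compactness of balls in a separable Hilbert space. -/
lemma exists_subseq_weak_tendsto {H : Type*} [NormedAddCommGroup H] [InnerProductSpace ℝ H]
    [CompleteSpace H] [TopologicalSpace.SeparableSpace H] {M : ℝ} (u : ℕ → H)
    (hu : ∀ n, ‖u n‖ ≤ M) :
    ∃ φ : ℕ → ℕ, StrictMono φ ∧ ∃ w : H, ∀ f : H,
      Tendsto (fun n => inner ℝ f (u (φ n))) atTop (𝓝 (inner ℝ f w)) := by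
  have hK := WeakDual.isSeqCompact_closedBall ℝ H (0 : StrongDual ℝ H) M
  let x : ℕ → WeakDual ℝ H := fun n =>
    StrongDual.toWeakDual (InnerProductSpace.toDual ℝ H (u n))
  have hx : ∀ n, x n ∈ WeakDual.toStrongDual ⁻¹' Metric.closedBall (0 : StrongDual ℝ H) M := by
    intro n
    have : ‖InnerProductSpace.toDual ℝ H (u n)‖ ≤ M := by
      simpa using hu n
    exact mem_closedBall_zero_iff.2 this
  obtain ⟨a, -, φ, hφ, ha⟩ := hK hx
  refine ⟨φ, hφ, (InnerProductSpace.toDual ℝ H).symm (WeakDual.toStrongDual a), fun f => ?_⟩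
  have h1 := (WeakDual.eval_continuous (𝕜 := ℝ) (E := H) f).tendsto a
  have h2 := h1.comp ha
  rw [real_inner_comm, InnerProductSpace.toDual_symm_apply]
  refine h2.congr fun n => ?_
  show inner ℝ (u (φ n)) f = _
  rw [real_inner_comm]

lemma exists_subseq_weak_tendsto_of_finite {H : Type*} [NormedAddCommGroup H]
    [InnerProductSpace ℝ H] [CompleteSpace H] [TopologicalSpace.SeparableSpace H] {M : ℝ} (k : ℕ)
    (u : ℕ → ℕ → H) (hu : ∀ n, ∀ i < k, ‖u n i‖ ≤ M) :
    ∃ φ : ℕ → ℕ, StrictMono φ ∧ ∃ w : ℕ → H, ∀ i < k, ∀ f : H,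
      Tendsto (fun n => inner ℝ f (u (φ n) i)) atTop (𝓝 (inner ℝ f (w i))) := by
  induction k with
  | zero => exact ⟨id, strictMono_id, fun _ => 0, fun i hi => absurd hi (Nat.not_lt_zero i)⟩
  | succ k ih =>
    obtain ⟨φ, hφ, w, hw⟩ := ih fun n i hi => hu n i (hi.trans k.lt_succ_self)
    obtain ⟨ψ, hψ, w', hw'⟩ := exists_subseq_weak_tendsto (fun n => u (φ n) k)
      fun n => hu _ k k.lt_succ_self
    refine ⟨φ ∘ ψ, hφ.comp hψ, fun i => if i < k then w i else w', fun i hi f => ?_⟩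
    rcases Nat.lt_succ_iff_lt_or_eq.1 hi with h | rfl
    · simpa [h] using! (hw i h f).comp hψ.tendsto_atTop
    · simpa using hw' f

lemma tendsto_integral_comp_angle {ψ : ℝ → ℝ} (hψ : Continuous ψ) (hb : ∀ x, |ψ x| ≤ 1)
    {u : ℕ → L2Line} {w : L2Line}
    (h : ∀ f : L2Line, Tendsto (fun n => inner ℝ f (u n)) atTop (𝓝 (inner ℝ f w))) :
    Tendsto (fun n => ∫ x in (0 : ℝ)..1, ψ (angle (u n) x)) atTop
      (𝓝 (∫ x in (0 : ℝ)..1, ψ (angle w x))) := by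
  refine intervalIntegral.tendsto_integral_filter_of_dominated_convergence (fun _ => 1) ?_ ?_ ?_ ?_
  · exact Eventually.of_forall fun n => (hψ.comp (continuous_angle _)).aestronglyMeasurable
  · exact Eventually.of_forall fun n => Eventually.of_forall fun x _ => by simpa using hb _
  · simp
  · exact Eventually.of_forall fun x _ => (hψ.tendsto _).comp (h (ker x))

lemma ClosesUp.of_weak_tendsto {u : ℕ → L2Line} {w : L2Line} (hu : ∀ n, ClosesUp (u n))
    (h : ∀ f : L2Line, Tendsto (fun n => inner ℝ f (u n)) atTop (𝓝 (inner ℝ f w))) :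
    ClosesUp w := by
  constructor
  · refine tendsto_nhds_unique
      (tendsto_integral_comp_angle Real.continuous_cos Real.abs_cos_le_one h) ?_
    simp [(hu _).1]
  · refine tendsto_nhds_unique
      (tendsto_integral_comp_angle Real.continuous_sin Real.abs_sin_le_one h) ?_
    simp [(hu _).2]

lemma normSum_le_of_weak_tendsto {k : ℕ} {u : ℕ → ℕ → L2Line} {w : ℕ → L2Line} {m : ℝ}
    (h : ∀ i < k, ∀ f : L2Line, Tendsto (fun n => inner ℝ f (u n i)) atTop (𝓝 (inner ℝ f (w i))))
    (hm : Tendsto (fun n => normSum k (u n)) atTop (𝓝 m)) : normSum k w ≤ m := by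
  have h1 : Tendsto (fun n => ∑ i ∈ Finset.range k, inner ℝ (‖w i‖⁻¹ • w i) (u n i)) atTop
      (𝓝 (∑ i ∈ Finset.range k, inner ℝ (‖w i‖⁻¹ • w i) (w i))) :=
    tendsto_finsetSum _ fun i hi => h i (Finset.mem_range.1 hi) _
  have h2 : ∑ i ∈ Finset.range k, inner ℝ (‖w i‖⁻¹ • w i) (w i) = normSum k w := by
    refine Finset.sum_congr rfl fun i _ => ?_
    rw [real_inner_smul_left, real_inner_self_eq_norm_sq]
    rcases eq_or_ne ‖w i‖ 0 with h | h
    · simp [h]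
    · field_simp
  rw [h2] at h1
  refine le_of_tendsto_of_tendsto' h1 hm fun n => Finset.sum_le_sum fun i _ => ?_
  refine (real_inner_le_norm _ _).trans ?_
  have : ‖‖w i‖⁻¹ • w i‖ ≤ 1 := by
    rw [norm_smul, norm_inv, norm_norm]; exact inv_mul_le_one
  exact mul_le_of_le_one_left (norm_nonneg _) this

/-- The densities of `k` circles, each run through once. -/
lemma exists_admissible (k : ℕ) : ∃ u, Admissible k u := by
  let c : L2Line := (2 * Real.pi) • ker 1
  have hc : ∀ x ∈ Icc (0 : ℝ) 1, angle c x = 2 * Real.pi * x := fun x hx => by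
    simp only [angle, c]
    rw [real_inner_smul_right, inner_ker_ker hx.1 zero_le_one, min_eq_left hx.2]
  have hpi : (2 * Real.pi) ≠ 0 := by positivity
  refine ⟨fun _ => c, fun _ _ => ⟨?_, ?_⟩, ?_⟩
  · rw [intervalIntegral.integral_congr (g := fun x => Real.cos (2 * Real.pi * x)),
      intervalIntegral.integral_comp_mul_left _ hpi]
    · simp
    · intro x hx
      rw [uIcc_of_le zero_le_one] at hx
      simp only [hc x hx]
  · rw [intervalIntegral.integral_congr (g := fun x => Real.sin (2 * Real.pi * x)),
      intervalIntegral.integral_comp_mul_left _ hpi]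
    · simp
    · intro x hx
      rw [uIcc_of_le zero_le_one] at hx
      simp only [hc x hx]
  · rw [Finset.sum_const, Finset.card_range, hc 1 (by simp), mul_one, nsmul_eq_mul]
    exact Real.cos_nat_mul_two_pi k

/-- Direct method: the constraints are weakly sequentially closed, the functional is weakly lower
semicontinuous. -/
theorem exists_minimizer (k : ℕ) :
    ∃ u, Admissible k u ∧ ∀ v, Admissible k v → normSum k u ≤ normSum k v := by
  let S : Set ℝ := normSum k '' {u | Admissible k u}
  obtain ⟨u₀, hu₀⟩ := exists_admissible k
  have hS : S.Nonempty := ⟨_, u₀, hu₀, rfl⟩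
  have hb : BddBelow S := ⟨0, by rintro _ ⟨u, -, rfl⟩; exact normSum_nonneg k u⟩
  obtain ⟨s, -, hs, hsS⟩ := exists_seq_tendsto_sInf hS hb
  choose u hu hus using hsS
  have hlim : Tendsto (fun n => normSum k (u n)) atTop (𝓝 (sInf S)) := by simpa only [hus] using hs
  obtain ⟨M, hM⟩ := hlim.bddAbove_range
  have huM : ∀ n, ∀ i < k, ‖u n i‖ ≤ M := fun n i hi =>
    (Finset.single_le_sum (f := fun i => ‖u n i‖) (fun _ _ => norm_nonneg _)
      (Finset.mem_range.2 hi)).trans (hM ⟨n, rfl⟩)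
  obtain ⟨φ, hφ, w, hw⟩ := exists_subseq_weak_tendsto_of_finite k u huM
  refine ⟨w, ⟨fun i hi => ?_, ?_⟩, fun v hv => ?_⟩
  · exact ClosesUp.of_weak_tendsto (fun n => (hu (φ n)).closesUp i hi) (hw i hi)
  · have h1 : Tendsto (fun n => Real.cos (∑ i ∈ Finset.range k, angle (u (φ n) i) 1)) atTop
        (𝓝 (Real.cos (∑ i ∈ Finset.range k, angle (w i) 1))) :=
      (Real.continuous_cos.tendsto _).comp
        (tendsto_finsetSum _ fun i hi => hw i (Finset.mem_range.1 hi) (ker 1))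
    refine tendsto_nhds_unique h1 ?_
    simp [(hu _).cos_turning]
  · exact (normSum_le_of_weak_tendsto hw (hlim.comp hφ.tendsto_atTop)).trans
      (csInf_le hb ⟨v, hv, rfl⟩)

/-! ### The Euler–Lagrange equation of a single arc -/

lemma hasStrictFDerivAt_integral_comp_angle {ψ ψ' : ℝ → ℝ} (hψ : ∀ x, HasDerivAt ψ (ψ' x) x)
    (hψ' : Continuous ψ') (hb : ∀ x, |ψ' x| ≤ 1) (u : L2Line) :
    HasStrictFDerivAt (fun u : L2Line => ∫ x in (0 : ℝ)..1, ψ (angle u x))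
      (∫ x in (0 : ℝ)..1, ψ' (angle u x) • innerSL ℝ (ker x)) u := by
  have hψc : Continuous ψ := continuous_iff_continuousAt.2 fun x => (hψ x).continuousAt
  have hcont : ∀ u : L2Line, Continuous fun x => ψ' (angle u x) • innerSL ℝ (ker x) := fun u =>
    (hψ'.comp (continuous_angle u)).smul ((innerSL ℝ).continuous.comp continuous_ker)
  have hbound : ∀ u : L2Line, ∀ x ∈ uIoc (0 : ℝ) 1, ‖ψ' (angle u x) • innerSL ℝ (ker x)‖ ≤ 1 := by
    intro u x hx
    rw [uIoc_of_le zero_le_one] at hx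
    rw [norm_smul, innerSL_apply_norm]
    exact mul_le_one₀ (hb _) (norm_nonneg _) (norm_ker_le_one ⟨hx.1.le, hx.2⟩)
  refine hasStrictFDerivAt_of_hasFDerivAt_of_continuousAt
    (f' := fun u => ∫ x in (0 : ℝ)..1, ψ' (angle u x) • innerSL ℝ (ker x))
    (Eventually.of_forall fun w => ?_) ?_
  · refine intervalIntegral.hasFDerivAt_integral_of_dominated_of_fderiv_le (bound := fun _ => 1)
      (F := fun u x => ψ (angle u x)) (F' := fun u x => ψ' (angle u x) • innerSL ℝ (ker x))
      (s := univ) univ_mem ?_ ?_ ?_ ?_ ?_ ?_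
    · exact Eventually.of_forall fun z => (hψc.comp (continuous_angle z)).aestronglyMeasurable
    · exact (hψc.comp (continuous_angle w)).intervalIntegrable _ _
    · exact (hcont w).aestronglyMeasurable
    · exact Eventually.of_forall fun x hx z _ => hbound z x hx
    · simp
    · exact Eventually.of_forall fun x _ z _ =>
        (hψ _).comp_hasFDerivAt z (innerSL ℝ (ker x)).hasFDerivAt
  · refine Continuous.continuousAt ?_
    refine intervalIntegral.continuous_of_dominated_interval (bound := fun _ => 1) ?_ ?_ ?_ ?_
    · exact fun w => (hcont w).aestronglyMeasurable
    · exact fun w => Eventually.of_forall fun x hx => hbound w x hx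
    · simp
    · exact Eventually.of_forall fun x _ =>
        (hψ'.comp (continuous_angle_left x)).smul continuous_const

lemma integral_smul_innerSL_apply {f : ℝ → ℝ} (hf : Continuous f) (w : L2Line) :
    (∫ x in (0 : ℝ)..1, f x • innerSL ℝ (ker x)) w = ∫ x in (0 : ℝ)..1, f x * angle w x := by
  rw [ContinuousLinearMap.intervalIntegral_apply]
  · rfl
  · exact (hf.smul ((innerSL ℝ).continuous.comp continuous_ker)).intervalIntegrable _ _

/-- The Lagrange multiplier rule for an arc of minimal `L²` curvature norm, in weak form; `p`, `q`,
`r` and `l` are the multipliers of the two closing conditions, of the total turning angle and of the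
functional `‖u‖²` itself. -/
lemma exists_multipliers {u : L2Line} (hu : ClosesUp u)
    (hmin : ∀ w, ClosesUp w → angle w 1 = angle u 1 → ‖u‖ ≤ ‖w‖) :
    ∃ p q r l : ℝ, ¬ (p = 0 ∧ q = 0 ∧ r = 0 ∧ l = 0) ∧ ∀ w : L2Line,
      (∫ x in (0 : ℝ)..1, (-p * Real.sin (angle u x) + q * Real.cos (angle u x)) * angle w x)
        + r * angle w 1 + 2 * l * inner ℝ u w = 0 := by
  let f : Fin 3 → L2Line → ℝ := ![fun u => ∫ x in (0 : ℝ)..1, Real.cos (angle u x),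
    fun u => ∫ x in (0 : ℝ)..1, Real.sin (angle u x), fun u => angle u 1]
  let f' : Fin 3 → StrongDual ℝ L2Line :=
    ![∫ x in (0 : ℝ)..1, (-Real.sin (angle u x)) • innerSL ℝ (ker x),
      ∫ x in (0 : ℝ)..1, Real.cos (angle u x) • innerSL ℝ (ker x), innerSL ℝ (ker 1)]
  have hf : ∀ i, HasStrictFDerivAt (f i) (f' i) u := by
    intro i
    fin_cases i
    · exact hasStrictFDerivAt_integral_comp_angle (ψ' := fun x => -Real.sin x) Real.hasDerivAt_cos
        (by fun_prop) (fun x => by simpa using Real.abs_sin_le_one x) u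
    · exact hasStrictFDerivAt_integral_comp_angle Real.hasDerivAt_sin
        (by fun_prop) Real.abs_cos_le_one u
    · exact (innerSL ℝ (ker 1)).hasStrictFDerivAt
  have hext : IsLocalExtrOn (fun w : L2Line => ‖w‖ ^ 2) {w | ∀ i, f i w = f i u} u := by
    refine Or.inl (IsMinOn.localize fun w hw => ?_)
    have h0 : ∫ x in (0 : ℝ)..1, Real.cos (angle w x) = _ := hw 0
    have h1 : ∫ x in (0 : ℝ)..1, Real.sin (angle w x) = _ := hw 1
    have h2 : angle w 1 = angle u 1 := hw 2
    exact pow_le_pow_left₀ (norm_nonneg _) (hmin w ⟨h0.trans hu.1, h1.trans hu.2⟩ h2) 2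
  obtain ⟨Λ, l, hne, hΛ⟩ := hext.exists_multipliers_of_hasStrictFDerivAt hf
    (hasStrictFDerivAt_norm_sq u)
  refine ⟨Λ 0, Λ 1, Λ 2, l, ?_, fun w => ?_⟩
  · rintro ⟨h0, h1, h2, h3⟩
    refine hne (Prod.ext (funext fun i => ?_) h3)
    fin_cases i
    · exact h0
    · exact h1
    · exact h2
  · have h := congrArg (fun T : StrongDual ℝ L2Line => T w) hΛ
    simp only [Fin.sum_univ_three, f', add_apply, smul_apply, Matrix.cons_val, zero_apply,
      smul_eq_mul] at h
    rw [integral_smul_innerSL_apply (by fun_prop), integral_smul_innerSL_apply (by fun_prop)] at h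
    have e : ∫ x in (0 : ℝ)..1,
        (-Λ 0 * Real.sin (angle u x) + Λ 1 * Real.cos (angle u x)) * angle w x
        = Λ 0 * (∫ x in (0 : ℝ)..1, -Real.sin (angle u x) * angle w x)
          + Λ 1 * ∫ x in (0 : ℝ)..1, Real.cos (angle u x) * angle w x := by
      rw [← intervalIntegral.integral_const_mul, ← intervalIntegral.integral_const_mul,
        ← intervalIntegral.integral_add]
      · exact intervalIntegral.integral_congr fun x _ => by ring
      · exact Continuous.intervalIntegrable (by fun_prop) _ _
      · exact Continuous.intervalIntegrable (by fun_prop) _ _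
    rw [e]
    simp only [innerSL_apply_apply, nsmul_eq_mul, Nat.cast_ofNat] at h
    have e2 : angle w 1 = inner ℝ (ker 1) w := rfl
    rw [e2]
    linarith [h]

/-- The solution `y ↦ ∫₀¹ f(x) min(x, y) dx` of `-G'' = f`, `G(0) = 0`, `G'(1) = 0`. -/
def greenPotential (f : ℝ → ℝ) (y : ℝ) : ℝ :=
  (∫ x in (0 : ℝ)..y, x * f x) + y * ∫ x in y..1, f x

lemma greenPotential_eq {f : ℝ → ℝ} (hf : Continuous f) {y : ℝ} (hy : y ∈ Icc (0 : ℝ) 1) :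
    ∫ x in (0 : ℝ)..1, f x * min x y = greenPotential f y := by
  have hc : Continuous fun x => f x * min x y := by fun_prop
  rw [← intervalIntegral.integral_add_adjacent_intervals (hc.intervalIntegrable 0 y)
    (hc.intervalIntegrable y 1), greenPotential, ← intervalIntegral.integral_const_mul]
  congr 1
  · refine intervalIntegral.integral_congr fun x hx => ?_
    rw [uIcc_of_le hy.1] at hx
    simp only [min_eq_left hx.2, mul_comm]
  · refine intervalIntegral.integral_congr fun x hx => ?_
    rw [uIcc_of_le hy.2] at hx
    simp only [min_eq_right hx.1, mul_comm]

lemma hasDerivAt_integral_right {f : ℝ → ℝ} (hf : Continuous f) (y : ℝ) :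
    HasDerivAt (fun y => ∫ x in y..1, f x) (-f y) y :=
  intervalIntegral.integral_hasDerivAt_left (hf.intervalIntegrable _ _)
    (hf.stronglyMeasurableAtFilter _ _) hf.continuousAt

lemma hasDerivAt_greenPotential {f : ℝ → ℝ} (hf : Continuous f) (y : ℝ) :
    HasDerivAt (greenPotential f) (∫ x in y..1, f x) y := by
  have hc : Continuous fun x => x * f x := by fun_prop
  have h1 : HasDerivAt (fun y => ∫ x in (0 : ℝ)..y, x * f x) (y * f y) y :=
    intervalIntegral.integral_hasDerivAt_right (hc.intervalIntegrable _ _)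
      (hc.stronglyMeasurableAtFilter _ _) hc.continuousAt
  have h2 := h1.add ((hasDerivAt_id y).mul (hasDerivAt_integral_right hf y))
  refine (h2.congr_deriv ?_)
  simp only [id_eq]
  ring

/-- The multiplier of the functional itself does not vanish: otherwise the tangent of the arc would
be constant, and the arc would not close up. -/
lemma multiplier_ne_zero {u : L2Line} (hu : ClosesUp u) {p q r l : ℝ}
    (hne : ¬ (p = 0 ∧ q = 0 ∧ r = 0 ∧ l = 0))
    (hG : ∀ y ∈ Icc (0 : ℝ) 1, greenPotential
      (fun x => -p * Real.sin (angle u x) + q * Real.cos (angle u x)) y + r * y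
        + 2 * l * angle u y = 0) : l ≠ 0 := by
  rintro rfl
  set f : ℝ → ℝ := fun x => -p * Real.sin (angle u x) + q * Real.cos (angle u x) with hfdef
  have hf : Continuous f := by fun_prop
  have huniq : ∀ y ∈ Icc (0 : ℝ) 1, UniqueDiffWithinAt ℝ (Icc (0 : ℝ) 1) y :=
    uniqueDiffOn_Icc zero_lt_one
  have h1 : ∀ y ∈ Icc (0 : ℝ) 1, (∫ x in y..1, f x) + r = 0 := by
    intro y hy
    have hd : HasDerivWithinAt (fun y => greenPotential f y + r * y) ((∫ x in y..1, f x) + r)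
        (Icc 0 1) y := by
      exact (((hasDerivAt_greenPotential hf y).add
        ((hasDerivAt_id y).const_mul r)).congr_deriv (by simp)).hasDerivWithinAt
    have h0 : HasDerivWithinAt (fun y => greenPotential f y + r * y) 0 (Icc 0 1) y :=
      (hasDerivWithinAt_const y (Icc (0 : ℝ) 1) (0 : ℝ)).congr_of_mem
        (fun z hz => by simpa using hG z hz) hy
    exact (huniq y hy).eq_deriv _ hd h0
  have h2 : ∀ y ∈ Icc (0 : ℝ) 1, f y = 0 := by
    intro y hy
    have hd : HasDerivWithinAt (fun y => (∫ x in y..1, f x) + r) (-f y) (Icc 0 1) y :=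
      ((hasDerivAt_integral_right hf y).add_const r).hasDerivWithinAt
    have h0 : HasDerivWithinAt (fun y => (∫ x in y..1, f x) + r) 0 (Icc 0 1) y :=
      (hasDerivWithinAt_const y (Icc (0 : ℝ) 1) (0 : ℝ)).congr_of_mem h1 hy
    have := (huniq y hy).eq_deriv _ hd h0
    linarith
  have hr : r = 0 := by simpa using h1 1 (by simp)
  set h : ℝ → ℝ := fun x => p * Real.cos (angle u x) + q * Real.sin (angle u x) with hhdef
  have hh : Continuous h := by fun_prop
  have hint : ∫ x in (0 : ℝ)..1, h x = 0 := by
    simp only [hhdef]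
    rw [intervalIntegral.integral_add, intervalIntegral.integral_const_mul,
      intervalIntegral.integral_const_mul, hu.1, hu.2]
    · simp
    · exact Continuous.intervalIntegrable (by fun_prop) _ _
    · exact Continuous.intervalIntegrable (by fun_prop) _ _
  -- By Rolle's theorem `h` vanishes somewhere, while `f² + h² = p² + q²` everywhere.
  obtain ⟨c, hc, hhc⟩ := exists_hasDerivAt_eq_zero (f := fun y => ∫ x in (0 : ℝ)..y, h x) (f' := h)
    zero_lt_one (by
      have : Continuous fun y => ∫ x in (0 : ℝ)..y, h x :=
        intervalIntegral.continuous_primitive (fun _ _ => hh.intervalIntegrable _ _) 0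
      exact this.continuousOn) (by simp [hint])
    fun x _ => intervalIntegral.integral_hasDerivAt_right (hh.intervalIntegrable _ _)
      (hh.stronglyMeasurableAtFilter _ _) hh.continuousAt
  have hfc := h2 c ⟨hc.1.le, hc.2.le⟩
  have hsum : p ^ 2 + q ^ 2 = 0 := by
    have e : f c ^ 2 + h c ^ 2 = (p ^ 2 + q ^ 2) *
        (Real.sin (angle u c) ^ 2 + Real.cos (angle u c) ^ 2) := by
      simp only [hfdef, hhdef]; ring
    rw [Real.sin_sq_add_cos_sq, hfc, hhc] at e
    linarith
  have hp : p = 0 := by nlinarith [sq_nonneg p, sq_nonneg q]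
  have hq : q = 0 := by nlinarith [sq_nonneg p, sq_nonneg q]
  exact hne ⟨hp, hq, hr, rfl⟩

/-- An arc of minimal `L²` curvature norm `‖u‖`, for a given total turning angle, solves the
equation `2 v'' + v³ - ‖u‖² v = 0`. The constant in it is determined by the closing condition, via
the first integral `v² - 2 ⟨ν, T⟩ = ‖u‖²` of `v' = ⟨ν, N⟩`. -/
theorem exists_euler_lagrange {u : L2Line} (hu : ClosesUp u)
    (hmin : ∀ w, ClosesUp w → angle w 1 = angle u 1 → ‖u‖ ≤ ‖w‖) :
    ∃ v v₁ : ℝ → ℝ, Continuous v ∧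
      (∀ y ∈ Icc (0 : ℝ) 1, HasDerivWithinAt (angle u) (v y) (Icc 0 1) y) ∧
      (∀ y ∈ Icc (0 : ℝ) 1, HasDerivWithinAt v (v₁ y) (Icc 0 1) y) ∧
      (∀ y ∈ Icc (0 : ℝ) 1,
        HasDerivWithinAt v₁ ((‖u‖ ^ 2 * v y - v y ^ 3) / 2) (Icc 0 1) y) ∧
      ∫ y in (0 : ℝ)..1, v y ^ 2 = ‖u‖ ^ 2 := by
  obtain ⟨p, q, r, l, hne, hw⟩ := exists_multipliers hu hmin
  set f : ℝ → ℝ := fun x => -p * Real.sin (angle u x) + q * Real.cos (angle u x) with hfdef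
  have hf : Continuous f := by fun_prop
  have hG : ∀ y ∈ Icc (0 : ℝ) 1, greenPotential f y + r * y + 2 * l * angle u y = 0 := by
    intro y hy
    -- Tested with `1_(0,y]`, the multiplier rule becomes an integral equation for the angle.
    have h := hw (ker y)
    rw [real_inner_comm] at h
    have e1 : angle (ker y) 1 = y := by
      rw [angle, inner_ker_ker zero_le_one hy.1, min_eq_right hy.2]
    have e2 : ∫ x in (0 : ℝ)..1, f x * angle (ker y) x = greenPotential f y := by
      rw [← greenPotential_eq hf hy]
      refine intervalIntegral.integral_congr fun x hx => ?_
      rw [uIcc_of_le zero_le_one] at hx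
      simp only [angle, inner_ker_ker hx.1 hy.1]
    rw [e1] at h
    rw [← e2]
    exact h
  have hl : l ≠ 0 := multiplier_ne_zero hu hne hG
  set U : ℝ → ℝ := fun y => -(greenPotential f y + r * y) / (2 * l) with hUdef
  set v : ℝ → ℝ := fun y => -((∫ x in y..1, f x) + r) / (2 * l) with hvdef
  set v₁ : ℝ → ℝ := fun y => f y / (2 * l) with hv₁def
  set h : ℝ → ℝ := fun x => p * Real.cos (angle u x) + q * Real.sin (angle u x) with hhdef
  have hh : Continuous h := by fun_prop
  have hUeq : ∀ y ∈ Icc (0 : ℝ) 1, angle u y = U y := by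
    intro y hy
    have := hG y hy
    simp only [hUdef]
    field_simp
    linarith
  have hU : ∀ y, HasDerivAt U (v y) y := fun y => by
    have := (((hasDerivAt_greenPotential hf y).add
      ((hasDerivAt_id y).const_mul r)).neg).div_const (2 * l)
    exact this.congr_deriv (by simp [hvdef])
  have hv : ∀ y, HasDerivAt v (v₁ y) y := fun y => by
    have := (((hasDerivAt_integral_right hf y).add_const r).neg).div_const (2 * l)
    exact this.congr_deriv (by simp [hv₁def])
  have hvc : Continuous v := continuous_iff_continuousAt.2 fun y => (hv y).continuousAt
  have hUc : Continuous U := continuous_iff_continuousAt.2 fun y => (hU y).continuousAt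
  have hang : ∀ y ∈ Icc (0 : ℝ) 1, HasDerivWithinAt (angle u) (v y) (Icc 0 1) y :=
    fun y hy => (hU y).hasDerivWithinAt.congr_of_mem hUeq hy
  have hh' : ∀ y ∈ Icc (0 : ℝ) 1, HasDerivWithinAt h (f y * v y) (Icc 0 1) y := fun y hy => by
    have := ((hang y hy).cos.const_mul p).add ((hang y hy).sin.const_mul q)
    refine this.congr_deriv ?_
    simp only [hfdef]; ring
  have hf' : ∀ y ∈ Icc (0 : ℝ) 1, HasDerivWithinAt f (-(h y * v y)) (Icc 0 1) y := fun y hy => by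
    have := ((hang y hy).sin.const_mul (-p)).add ((hang y hy).cos.const_mul q)
    refine this.congr_deriv ?_
    simp only [hhdef]; ring
  -- The first integral of `v' = f / (2 l)`; up to a factor, `f` and `h` are `⟨ν, N⟩` and `⟨ν, T⟩`.
  have hfirst : ∀ y ∈ Icc (0 : ℝ) 1, v y ^ 2 - h y / l = v 0 ^ 2 - h 0 / l := by
    have hd : ∀ y ∈ Icc (0 : ℝ) 1,
        HasDerivWithinAt (fun y => v y ^ 2 - h y / l) 0 (Icc 0 1) y := fun y hy => by
      have := (((hv y).hasDerivWithinAt (s := Icc 0 1)).pow 2).sub ((hh' y hy).div_const l)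
      refine this.congr_deriv ?_
      simp only [hv₁def]
      field_simp
      ring
    refine constant_of_derivWithin_zero (fun y hy => (hd y hy).differentiableWithinAt)
      fun y hy => ?_
    have hy' : y ∈ Icc (0 : ℝ) 1 := ⟨hy.1, hy.2.le⟩
    exact (hd y hy').derivWithin (uniqueDiffOn_Icc zero_lt_one y hy')
  have hhint : ∫ x in (0 : ℝ)..1, h x = 0 := by
    simp only [hhdef]
    rw [intervalIntegral.integral_add, intervalIntegral.integral_const_mul,
      intervalIntegral.integral_const_mul, hu.1, hu.2]
    · simp
    · exact Continuous.intervalIntegrable (by fun_prop) _ _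
    · exact Continuous.intervalIntegrable (by fun_prop) _ _
  have hE : ∫ y in (0 : ℝ)..1, v y ^ 2 = v 0 ^ 2 - h 0 / l := by
    have e : ∫ y in (0 : ℝ)..1, (v y ^ 2 - h y / l) = v 0 ^ 2 - h 0 / l := by
      rw [intervalIntegral.integral_congr (g := fun _ => v 0 ^ 2 - h 0 / l)]
      · simp
      · intro y hy
        rw [uIcc_of_le zero_le_one] at hy
        exact hfirst y hy
    rw [intervalIntegral.integral_sub, intervalIntegral.integral_div, hhint] at e
    · simpa using e
    · exact Continuous.intervalIntegrable (by fun_prop) _ _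
    · exact Continuous.intervalIntegrable (by fun_prop) _ _
  -- Integration by parts, and the multiplier rule tested with `u` itself.
  have hE' : ∫ y in (0 : ℝ)..1, v y ^ 2 = ‖u‖ ^ 2 := by
    have hparts := intervalIntegral.integral_mul_deriv_eq_deriv_mul (a := 0) (b := 1)
      (fun y _ => hv y) (fun y _ => hU y)
      (Continuous.intervalIntegrable (by fun_prop) _ _) (hvc.intervalIntegrable _ _)
    have e1 : ∫ y in (0 : ℝ)..1, v y ^ 2 = ∫ y in (0 : ℝ)..1, v y * v y :=
      intervalIntegral.integral_congr fun y _ => by simp only [sq]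
    have e2 : ∫ y in (0 : ℝ)..1, v₁ y * U y
        = (∫ x in (0 : ℝ)..1, f x * angle u x) / (2 * l) := by
      rw [← intervalIntegral.integral_div]
      refine intervalIntegral.integral_congr fun y hy => ?_
      rw [uIcc_of_le zero_le_one] at hy
      simp only [hv₁def, ← hUeq y hy]
      ring
    have e3 : v 1 = -r / (2 * l) := by simp [hvdef]
    have e4 : U 0 = 0 := by rw [← hUeq 0 (by simp), angle_zero]
    have e5 := hw u
    rw [real_inner_self_eq_norm_sq] at e5
    rw [e1, hparts, e2, e3, e4, ← hUeq 1 (by simp)]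
    field_simp
    linarith
  refine ⟨v, v₁, hvc, hang, fun y _ => (hv y).hasDerivWithinAt, fun y hy => ?_, hE'⟩
  have hfy : v y ^ 2 - h y / l = ‖u‖ ^ 2 := by rw [hfirst y hy, ← hE, hE']
  refine ((hf' y hy).div_const (2 * l)).congr_deriv ?_
  rw [← hfy]
  field_simp
  ring

/-! ### Plane curves with prescribed angle function -/

/-- The Euclidean plane. -/
abbrev Plane : Type := EuclideanSpace ℝ (Fin 2)

/-- The unit vector with angle `θ`. -/
def dir (θ : ℝ) : Plane :=
  Real.cos θ • EuclideanSpace.single 0 1 + Real.sin θ • EuclideanSpace.single 1 1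

/-- The unit vector with angle `θ + π / 2`. -/
def dirNormal (θ : ℝ) : Plane :=
  -Real.sin θ • EuclideanSpace.single 0 1 + Real.cos θ • EuclideanSpace.single 1 1

lemma hasDerivAt_dir (θ : ℝ) : HasDerivAt dir (dirNormal θ) θ :=
  ((Real.hasDerivAt_cos θ).smul_const _).add ((Real.hasDerivAt_sin θ).smul_const _)

lemma hasDerivAt_dirNormal (θ : ℝ) : HasDerivAt dirNormal (-dir θ) θ := by
  have := ((Real.hasDerivAt_sin θ).neg.smul_const (EuclideanSpace.single 0 1 : Plane)).add
    ((Real.hasDerivAt_cos θ).smul_const (EuclideanSpace.single 1 1 : Plane))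
  refine this.congr_deriv ?_
  simp only [dir, neg_smul, neg_add]

lemma contDiff_dir {n : WithTop ℕ∞} : ContDiff ℝ n dir :=
  (Real.contDiff_cos.smul contDiff_const).add (Real.contDiff_sin.smul contDiff_const)

@[fun_prop]
lemma continuous_dir : Continuous dir := contDiff_dir (n := 0).continuous

lemma dir_apply_zero (θ : ℝ) : dir θ 0 = Real.cos θ := by simp [dir]

lemma dir_apply_one (θ : ℝ) : dir θ 1 = Real.sin θ := by simp [dir]

lemma dirNormal_apply_zero (θ : ℝ) : dirNormal θ 0 = -Real.sin θ := by simp [dirNormal]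

lemma dirNormal_apply_one (θ : ℝ) : dirNormal θ 1 = Real.cos θ := by simp [dirNormal]

@[simp] lemma norm_dir (θ : ℝ) : ‖dir θ‖ = 1 := by
  rw [EuclideanSpace.norm_eq, Fin.sum_univ_two, dir_apply_zero, dir_apply_one]
  simp

@[simp] lemma norm_dirNormal (θ : ℝ) : ‖dirNormal θ‖ = 1 := by
  rw [EuclideanSpace.norm_eq, Fin.sum_univ_two, dirNormal_apply_zero, dirNormal_apply_one]
  simp

lemma dir_ne_zero (θ : ℝ) : dir θ ≠ 0 := by
  rw [← norm_ne_zero_iff, norm_dir]; exact one_ne_zero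

@[simp] lemma inner_dir_dir (θ : ℝ) : inner ℝ (dir θ) (dir θ) = 1 := by
  rw [real_inner_self_eq_norm_sq, norm_dir, one_pow]

@[simp] lemma inner_dirNormal_dir (θ : ℝ) : inner ℝ (dirNormal θ) (dir θ) = 0 := by
  rw [PiLp.inner_apply, Fin.sum_univ_two, dir_apply_zero, dir_apply_one, dirNormal_apply_zero,
    dirNormal_apply_one]
  simp [mul_comm]

lemma contDiffOn_succ_of_hasDerivWithinAt {F : Type*} [NormedAddCommGroup F] [NormedSpace ℝ F]
    {f f' : ℝ → F} {S : Set ℝ} (hS : UniqueDiffOn ℝ S)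
    (hf : ∀ t ∈ S, HasDerivWithinAt f (f' t) S t) {n : ℕ} (hf' : ContDiffOn ℝ n f' S) :
    ContDiffOn ℝ (n + 1 : ℕ) f S := by
  rw [Nat.cast_succ, contDiffOn_succ_iff_derivWithin hS]
  refine ⟨fun t ht => (hf t ht).differentiableWithinAt, fun h => by simp at h, ?_⟩
  exact hf'.congr fun t ht => (hf t ht).derivWithin (hS t ht)

/-- A unit speed plane curve `g` with angle `θ` and signed curvature `c` is an elastica with
multiplier `lam` if `2 c'' + c³ - lam c = 0`. The equation is given as a first order system, from
which smoothness follows by bootstrapping. -/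
lemma isElastica_of_angle {g : ℝ → Plane} {θ c c₁ : ℝ → ℝ} {a b lam : ℝ} (hab : a < b)
    (hg : ∀ t ∈ Icc a b, HasDerivWithinAt g (dir (θ t)) (Icc a b) t)
    (hθ : ∀ t ∈ Icc a b, HasDerivWithinAt θ (c t) (Icc a b) t)
    (hc : ∀ t ∈ Icc a b, HasDerivWithinAt c (c₁ t) (Icc a b) t)
    (hc₁ : ∀ t ∈ Icc a b, HasDerivWithinAt c₁ ((lam * c t - c t ^ 3) / 2) (Icc a b) t) :
    IsElastica g a b lam := by
  set S := Icc a b with hS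
  have hu : UniqueDiffOn ℝ S := uniqueDiffOn_Icc hab
  have hsmooth : ∀ n : ℕ, ContDiffOn ℝ n θ S ∧ ContDiffOn ℝ n c S ∧ ContDiffOn ℝ n c₁ S := by
    intro n
    induction n with
    | zero =>
      simp only [Nat.cast_zero, contDiffOn_zero]
      exact ⟨fun t ht => (hθ t ht).continuousWithinAt, fun t ht => (hc t ht).continuousWithinAt,
        fun t ht => (hc₁ t ht).continuousWithinAt⟩
    | succ n ih =>
      refine ⟨contDiffOn_succ_of_hasDerivWithinAt hu hθ ih.2.1,
        contDiffOn_succ_of_hasDerivWithinAt hu hc ih.2.2,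
        contDiffOn_succ_of_hasDerivWithinAt hu hc₁ ?_⟩
      exact ((contDiffOn_const.mul ih.2.1).sub (ih.2.1.pow 3)).div_const 2
  have hderiv : ∀ t ∈ S, derivWithin g S t = dir (θ t) := fun t ht =>
    (hg t ht).derivWithin (hu t ht)
  have harc : ∀ ψ : ℝ → Plane, ∀ t ∈ S, arcDeriv S g ψ t = derivWithin ψ S t := fun ψ t ht => by
    rw [arcDeriv, hderiv t ht, norm_dir, inv_one, one_smul]
  have htan : ∀ t ∈ S, tangent S g t = dir (θ t) := fun t ht => by
    rw [tangent, harc g t ht, hderiv t ht]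
  have hdir : ∀ t ∈ S, HasDerivWithinAt (fun t => dir (θ t)) (c t • dirNormal (θ t)) S t :=
    fun t ht => (hasDerivAt_dir _).scomp_hasDerivWithinAt t (hθ t ht)
  have hdirN : ∀ t ∈ S, HasDerivWithinAt (fun t => dirNormal (θ t)) (c t • -dir (θ t)) S t :=
    fun t ht => (hasDerivAt_dirNormal _).scomp_hasDerivWithinAt t (hθ t ht)
  have hcurv : ∀ t ∈ S, curvature S g t = c t • dirNormal (θ t) := fun t ht => by
    rw [curvature, harc _ t ht]
    exact ((hdir t ht).congr_of_mem htan ht).derivWithin (hu t ht)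
  have hnorm : ∀ (ψ : ℝ → Plane) (h h' : ℝ → ℝ), (∀ t ∈ S, ψ t = h t • dirNormal (θ t)) →
      (∀ t ∈ S, HasDerivWithinAt h (h' t) S t) →
      ∀ t ∈ S, normalDeriv S g ψ t = h' t • dirNormal (θ t) := by
    intro ψ h h' hψ hh t ht
    have hd : derivWithin ψ S t = h t • c t • -dir (θ t) + h' t • dirNormal (θ t) :=
      (((hh t ht).smul (hdirN t ht)).congr_of_mem hψ ht).derivWithin (hu t ht)
    rw [normalDeriv, harc ψ t ht, htan t ht, hd, inner_add_left, real_inner_smul_left,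
      real_inner_smul_left, inner_neg_left, real_inner_smul_left, inner_dir_dir,
      inner_dirNormal_dir]
    module
  refine ⟨hab, ?_, fun t ht => ?_, fun t ht => ?_⟩
  · rw [contDiffOn_infty]
    intro n
    refine ContDiffOn.of_succ (n := n) ?_
    exact_mod_cast contDiffOn_succ_of_hasDerivWithinAt hu hg
      (contDiff_dir.comp_contDiffOn (hsmooth n).1)
  · rw [hderiv t ht]; exact dir_ne_zero _
  · rw [hnorm _ c₁ _ (hnorm _ c c₁ hcurv hc) hc₁ t ht, hcurv t ht, norm_smul, norm_dirNormal,
      mul_one, Real.norm_eq_abs, sq_abs]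
    module

/-! ### Closed curves with prescribed angle function -/

lemma lipschitzWith_dir : LipschitzWith 1 dir :=
  lipschitzWith_of_nnnorm_deriv_le (fun θ => (hasDerivAt_dir θ).differentiableAt) fun θ => by
    rw [(hasDerivAt_dir θ).deriv, ← NNReal.coe_le_coe, coe_nnnorm, norm_dirNormal, NNReal.coe_one]

/-- A Lipschitz angle function on `[0, 1]` whose unit tangent closes up to first order and has
vanishing integral belongs to a closed unit speed `H²`-curve. -/
lemma exists_closed_curve {θ : ℝ → ℝ} {M : ℝ≥0} (hθ : LipschitzOnWith M θ (Icc 0 1))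
    (h01 : dir (θ 0) = dir (θ 1)) (hint : ∫ t in (0 : ℝ)..1, dir (θ t) = 0) :
    ∃ γ : UnitAddCircle → Plane, IsH2 γ ∧ (∀ t, ‖deriv (lift γ) t‖ = 1) ∧
      (∀ t ∈ Icc (0 : ℝ) 1, HasDerivAt (lift γ) (dir (θ t)) t) ∧
      ∀ t ∈ Icc (0 : ℝ) 1, lift γ t = ∫ s in (0 : ℝ)..t, dir (θ s) := by
  set T : ℝ → Plane := fun t => dir (θ (Int.fract t)) with hT
  have hT01 : ∀ t ∈ Icc (0 : ℝ) 1, T t = dir (θ t) := by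
    intro t ht
    rcases eq_or_lt_of_le ht.2 with h | h
    · rw [h, hT, ← h01]; simp
    · simp only [hT, Int.fract_eq_self.2 ⟨ht.1, h⟩]
  have hTc : Continuous T := by
    refine ContinuousOn.comp_fract (s := id) (f := fun _ t => dir (θ t)) ?_ continuous_id
      fun _ => h01
    exact (continuous_dir.comp_continuousOn hθ.continuousOn).comp continuousOn_snd
      fun x hx => hx.2
  have hTp : Function.Periodic T 1 := fun t => by simp [hT]
  set g : ℝ → Plane := fun t => ∫ s in (0 : ℝ)..t, T s with hg
  have hcongr : ∀ t ∈ Icc (0 : ℝ) 1, g t = ∫ s in (0 : ℝ)..t, dir (θ s) := fun t ht =>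
    intervalIntegral.integral_congr fun s hs => by
      rw [uIcc_of_le ht.1] at hs
      exact hT01 s ⟨hs.1, hs.2.trans ht.2⟩
  have hgp : Function.Periodic g 1 := fun t => by
    have e : ∫ s in t..t + 1, T s = 0 := by
      rw [hTp.intervalIntegral_add_eq t 0, zero_add, ← hint, ← hcongr 1 (by simp)]
    simp only [hg]
    rw [← intervalIntegral.integral_add_adjacent_intervals (hTc.intervalIntegrable 0 t)
      (hTc.intervalIntegrable t (t + 1)), e, add_zero]
  have hderiv : ∀ t, HasDerivAt g (T t) t := fun t =>
    intervalIntegral.integral_hasDerivAt_right (hTc.intervalIntegrable _ _)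
      (hTc.stronglyMeasurableAtFilter _ _) hTc.continuousAt
  have hlift : lift (hgp.lift) = g := funext fun t => hgp.lift_coe t
  have hdg : deriv g = T := funext fun t => (hderiv t).deriv
  have hTlip : LipschitzOnWith M T (Icc 0 1) := by
    have h := lipschitzWith_dir.comp_lipschitzOnWith hθ
    rw [one_mul] at h
    intro x hx y hy
    rw [hT01 x hx, hT01 y hy]
    exact h hx hy
  refine ⟨hgp.lift, ⟨?_, ?_, ?_⟩, fun t => ?_, fun t ht => ?_, fun t ht => ?_⟩
  · rw [hlift, contDiff_one_iff_deriv, hdg]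
    exact ⟨fun t => (hderiv t).differentiableAt, hTc⟩
  · rw [hlift, hdg]
    rw [← uIcc_of_le (zero_le_one' ℝ)] at hTlip
    exact hTlip.absolutelyContinuousOnInterval
  · rw [hlift, hdg]
    refine MemLp.of_bound (aestronglyMeasurable_deriv _ _) M ?_
    rw [← Measure.restrict_congr_set Ioo_ae_eq_Icc, ae_restrict_iff' measurableSet_Ioo]
    exact Eventually.of_forall fun t ht =>
      norm_deriv_le_of_lipschitzOn (Icc_mem_nhds ht.1 ht.2) hTlip
  · rw [hlift, hdg]; exact norm_dir _
  · rw [hlift, ← hT01 t ht]; exact hderiv t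
  · rw [hlift]; exact hcongr t ht

/-- The curvature of a unit speed curve is the derivative of its angle. -/
lemma norm_curvature_of_angle {g : ℝ → Plane} {θ : ℝ → ℝ} {a b t c : ℝ} (ht : t ∈ Ioo a b)
    (hu : ∀ s, ‖deriv g s‖ = 1) (hg : ∀ s ∈ Icc a b, HasDerivAt g (dir (θ s)) s)
    (hθ : HasDerivAt θ c t) :
    ‖curvature univ g t‖ ^ 2 * ‖deriv g t‖ = c ^ 2 := by
  have harc : ∀ (ψ : ℝ → Plane) s, arcDeriv univ g ψ s = deriv ψ s := fun ψ s => by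
    rw [arcDeriv, derivWithin_univ, hu, inv_one, one_smul, derivWithin_univ]
  have hT : tangent univ g = deriv g := funext fun s => harc g s
  have he : deriv g =ᶠ[𝓝 t] fun s => dir (θ s) := by
    filter_upwards [Icc_mem_nhds ht.1 ht.2] with s hs using (hg s hs).deriv
  have hd : HasDerivAt (deriv g) (c • dirNormal (θ t)) t :=
    ((hasDerivAt_dir _).scomp t hθ).congr_of_eventuallyEq he
  rw [curvature, harc, hT, hd.deriv, hu, norm_smul, norm_dirNormal, mul_one, mul_one,
    Real.norm_eq_abs, sq_abs]

/-! ### Joining closed arcs -/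

lemma hasDerivWithinAt_rescale {f f' : ℝ → ℝ}
    (h : ∀ y ∈ Icc (0 : ℝ) 1, HasDerivWithinAt f (f' y) (Icc 0 1) y) (a : ℝ) {l : ℝ} (hl : 0 < l) :
    ∀ t ∈ Icc a (a + l),
      HasDerivWithinAt (fun t => f ((t - a) / l)) (f' ((t - a) / l) / l) (Icc a (a + l)) t := by
  intro t ht
  have hmaps : MapsTo (fun t => (t - a) / l) (Icc a (a + l)) (Icc 0 1) := fun s hs =>
    ⟨div_nonneg (by linarith [hs.1]) hl.le, (div_le_one hl).2 (by linarith [hs.2])⟩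
  have h1 : HasDerivWithinAt (fun t => (t - a) / l) (1 / l) (Icc a (a + l)) t :=
    (((hasDerivAt_id t).sub_const a).div_const l).hasDerivWithinAt
  exact ((h _ (hmaps ht)).comp t h1 hmaps).congr_deriv (by ring)

lemma integral_rescale {F : Type*} [NormedAddCommGroup F] [NormedSpace ℝ F] (f : ℝ → F) (a : ℝ)
    {l : ℝ} (hl : 0 < l) :
    ∫ t in a..a + l, f ((t - a) / l) = l • ∫ x in (0 : ℝ)..1, f x := by
  simp_rw [sub_div]
  rw [intervalIntegral.integral_comp_div_sub _ hl.ne']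
  congr 2
  · ring
  · field_simp; ring

lemma integral_dir_add_angle {u : L2Line} (hu : ClosesUp u) (A : ℝ) :
    ∫ x in (0 : ℝ)..1, dir (A + angle u x) = 0 := by
  have h : ∀ x, dir (A + angle u x)
      = Real.cos (angle u x) • dir A + Real.sin (angle u x) • dirNormal A := fun x => by
    simp only [dir, dirNormal, Real.cos_add, Real.sin_add]
    module
  simp_rw [h]
  rw [intervalIntegral.integral_add, intervalIntegral.integral_smul_const,
    intervalIntegral.integral_smul_const, hu.1, hu.2]
  · simp
  · exact Continuous.intervalIntegrable (by fun_prop) _ _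
  · exact Continuous.intervalIntegrable (by fun_prop) _ _

/-- The end points of consecutive intervals of lengths `l 0, l 1, …`, starting at `0`. -/
def cutPoint (l : ℕ → ℝ) (n : ℕ) : ℝ := ∑ i ∈ Finset.range n, l i

lemma cutPoint_zero (l : ℕ → ℝ) : cutPoint l 0 = 0 := by simp [cutPoint]

lemma cutPoint_succ (l : ℕ → ℝ) (n : ℕ) : cutPoint l (n + 1) = cutPoint l n + l n :=
  Finset.sum_range_succ _ _

lemma cutPoint_mono {k : ℕ} {l : ℕ → ℝ} (hl : ∀ i < k, 0 < l i) {m n : ℕ} (hmn : m ≤ n)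
    (hn : n ≤ k) : cutPoint l m ≤ cutPoint l n :=
  Finset.sum_le_sum_of_subset_of_nonneg (by simpa using hmn) fun i hi _ =>
    (hl i ((Finset.mem_range.1 hi).trans_le hn)).le

lemma cutPoint_lt {k : ℕ} {l : ℕ → ℝ} (hl : ∀ i < k, 0 < l i) {m n : ℕ} (hmn : m < n)
    (hn : n ≤ k) : cutPoint l m < cutPoint l n := by
  refine lt_of_lt_of_le ?_ (cutPoint_mono hl hmn hn)
  rw [cutPoint_succ]
  linarith [hl m (hmn.trans_le hn)]

/-- The angle of the curve that runs through the arcs with curvature densities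
`u 0, …, u (k - 1)`, rescaled to lengths `l 0, …, l (k - 1)`, one after the other. Each summand is
constant outside the parameter interval of its arc. -/
def joinedAngle (k : ℕ) (l : ℕ → ℝ) (u : ℕ → L2Line) (t : ℝ) : ℝ :=
  ∑ i ∈ Finset.range k, angle (u i) (max 0 (min ((t - cutPoint l i) / l i) 1))

lemma joinedAngle_eq {k : ℕ} {l : ℕ → ℝ} (hl : ∀ i < k, 0 < l i) (u : ℕ → L2Line) {j : ℕ}
    (hj : j < k) {t : ℝ} (ht : t ∈ Icc (cutPoint l j) (cutPoint l j + l j)) :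
    joinedAngle k l u t = ∑ i ∈ Finset.range j, angle (u i) 1
      + angle (u j) ((t - cutPoint l j) / l j) := by
  have hlj := hl j hj
  rw [joinedAngle, ← Finset.sum_subset (s₁ := Finset.range (j + 1)), Finset.sum_range_succ]
  · congr 1
    · refine Finset.sum_congr rfl fun i hi => ?_
      have hij : i + 1 ≤ j := Finset.mem_range.1 hi
      have h1 := cutPoint_mono hl hij hj.le
      rw [cutPoint_succ] at h1
      have hli := hl i (by omega)
      have h2 : 1 ≤ (t - cutPoint l i) / l i := by
        rw [one_le_div hli]; linarith [ht.1]
      rw [min_eq_right h2, max_eq_right zero_le_one]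
    · have h1 : (t - cutPoint l j) / l j ≤ 1 := (div_le_one hlj).2 (by linarith [ht.2])
      have h2 : 0 ≤ (t - cutPoint l j) / l j := div_nonneg (by linarith [ht.1]) hlj.le
      rw [min_eq_left h1, max_eq_right h2]
  · simp [hj]
  · intro i hi hij
    have hik := Finset.mem_range.1 hi
    have hji : j + 1 ≤ i := by simpa using hij
    have h1 := cutPoint_mono hl hji hik.le
    rw [cutPoint_succ] at h1
    have h2 : (t - cutPoint l i) / l i ≤ 0 :=
      div_nonpos_of_nonpos_of_nonneg (by linarith [ht.2]) (hl i hik).le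
    rw [max_eq_left ((min_le_left _ _).trans h2), angle_zero]

lemma exists_lipschitzWith_joinedAngle {k : ℕ} {l : ℕ → ℝ} (hl : ∀ i < k, 0 < l i)
    {u : ℕ → L2Line} (hu : ∀ i < k, ∃ M : ℝ≥0, LipschitzOnWith M (angle (u i)) (Icc 0 1)) :
    ∃ M : ℝ≥0, LipschitzWith M (joinedAngle k l u) := by
  have hsum : ∀ s : Finset ℕ, (∀ i ∈ s, i < k) → ∃ M : ℝ≥0, LipschitzWith M fun t =>
      ∑ i ∈ s, angle (u i) (max 0 (min ((t - cutPoint l i) / l i) 1)) := by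
    intro s
    induction s using Finset.induction_on with
    | empty => exact fun _ => ⟨0, by simp⟩
    | insert i s hi ih =>
      intro hs
      obtain ⟨M, hM⟩ := ih fun j hj => hs j (Finset.mem_insert_of_mem hj)
      have hik := hs i (Finset.mem_insert_self _ _)
      obtain ⟨N, hN⟩ := hu i hik
      have hli := hl i hik
      have haff : LipschitzWith (Real.toNNReal (l i)⁻¹) fun t => (t - cutPoint l i) / l i :=
        LipschitzWith.of_dist_le_mul fun x y => by
          rw [Real.dist_eq, Real.dist_eq, ← sub_div, abs_div, abs_of_pos hli,
            Real.coe_toNNReal _ (inv_pos.2 hli).le,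
            sub_sub_sub_cancel_right, div_eq_inv_mul]
      have hclamp := (haff.min_const 1).const_max 0
      have hcomp : LipschitzWith _ fun t =>
          angle (u i) (max 0 (min ((t - cutPoint l i) / l i) 1)) :=
        lipschitzOnWith_univ.1 (hN.comp (lipschitzOnWith_univ.2 hclamp) fun t _ =>
          ⟨le_max_left _ _, max_le zero_le_one (min_le_right _ _)⟩)
      refine ⟨N * (l i)⁻¹.toNNReal + M, ?_⟩
      simp_rw [Finset.sum_insert hi]
      exact hcomp.add hM
  exact hsum (Finset.range k) fun i hi => Finset.mem_range.1 hi

lemma ClosesUp.ne_zero {u : L2Line} (hu : ClosesUp u) : u ≠ 0 := by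
  rintro rfl
  have := hu.1
  simp [angle] at this

/-- In a minimizing family every arc minimizes for its own total turning angle. -/
lemma norm_le_of_minimizer {k : ℕ} {u : ℕ → L2Line} (hu : Admissible k u)
    (hmin : ∀ v, Admissible k v → normSum k u ≤ normSum k v) {i : ℕ} (hi : i < k) {w : L2Line}
    (hw : ClosesUp w) (hw1 : angle w 1 = angle (u i) 1) : ‖u i‖ ≤ ‖w‖ := by
  have hi' : i ∈ Finset.range k := Finset.mem_range.2 hi
  have hadm : Admissible k (Function.update u i w) := by
    refine ⟨fun j hj => ?_, ?_⟩
    · rcases eq_or_ne j i with rfl | h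
      · simpa using hw
      · simpa [h] using hu.closesUp j hj
    · refine Eq.trans (congrArg Real.cos (Finset.sum_congr rfl fun j _ => ?_)) hu.cos_turning
      rcases eq_or_ne j i with rfl | h
      · simpa using hw1
      · simp [h]
  have h := hmin _ hadm
  unfold normSum at h
  rw [← Finset.add_sum_erase _ _ hi', ← Finset.add_sum_erase _ _ hi'] at h
  have e : ∑ j ∈ (Finset.range k).erase i, ‖Function.update u i w j‖
      = ∑ j ∈ (Finset.range k).erase i, ‖u j‖ :=
    Finset.sum_congr rfl fun j hj => by
      rw [Function.update_of_ne (Finset.ne_of_mem_erase hj)]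
  rw [e, Function.update_self] at h
  linarith

lemma hasMultiplicity_of_injOn {γ : UnitAddCircle → Plane} {p : Plane} {k : ℕ} {a : ℕ → ℝ}
    (ha : ∀ i < k, a i ∈ Ico (0 : ℝ) 1) (hinj : InjOn a (Iio k)) (hp : ∀ i < k, lift γ (a i) = p) :
    HasMultiplicity γ p k := by
  have hinj' : InjOn (fun i => (a i : UnitAddCircle)) (Iio k) := by
    intro i hi j hj hij
    refine hinj hi hj ?_
    have hI : ∀ n < k, a n ∈ Ico (0 : ℝ) (0 + 1) := fun n hn => by simpa using ha n hn
    exact (AddCircle.coe_eq_coe_iff_of_mem_Ico (hI i hi) (hI j hj)).1 hij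
  have h1 : ((fun i => (a i : UnitAddCircle)) '' Iio k).encard = k := by
    
    rw [hinj'.encard_image, ← Finset.coe_range, encard_coe_eq_coe_finsetCard, Finset.card_range]
  rw [HasMultiplicity, ← h1]
  refine encard_le_encard ?_
  rintro _ ⟨i, hi, rfl⟩
  exact hp i hi

/-- The arcs of a minimizing family, rescaled to lengths proportional to `‖u i‖`, form a closed
curve. These lengths turn the individual constants `‖u i‖²` in the Euler–Lagrange equations into one
and the same multiplier. -/
theorem exists_curve_of_minimizer {k : ℕ} (hk : 1 ≤ k) {u : ℕ → L2Line} (hu : Admissible k u)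
    (hmin : ∀ v, Admissible k v → normSum k u ≤ normSum k v) :
    ∃ γ ∈ curveClass k, normalizedBending γ = normSum k u ^ 2 ∧
      ∃ p, HasMultiplicity γ p k ∧ ∃ a : ℕ → ℝ, (∀ i < k, a i < a (i + 1)) ∧ a k = a 0 + 1 ∧
        (∀ i ≤ k, γ (a i : UnitAddCircle) = p) ∧ ∃ lam : ℝ, 0 < lam ∧
          ∀ i < k, IsElastica (lift γ) (a i) (a (i + 1)) lam := by
  have hpos : ∀ i < k, 0 < ‖u i‖ := fun i hi => norm_pos_iff.2 (hu.closesUp i hi).ne_zero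
  set S := normSum k u with hSdef
  have hS : 0 < S := Finset.sum_pos (fun i hi => hpos i (Finset.mem_range.1 hi))
    ⟨0, Finset.mem_range.2 hk⟩
  set l : ℕ → ℝ := fun i => ‖u i‖ / S with hldef
  have hl : ∀ i < k, 0 < l i := fun i hi => div_pos (hpos i hi) hS
  set a := cutPoint l with hadef
  have ha0 : a 0 = 0 := cutPoint_zero l
  have hak : a k = 1 := by
    simp only [hadef, cutPoint, hldef]
    rw [← Finset.sum_div]
    exact div_self hS.ne'
  have hasucc : ∀ i, a (i + 1) = a i + l i := cutPoint_succ l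
  have ha01 : ∀ i ≤ k, a i ∈ Icc (0 : ℝ) 1 := fun i hi =>
    ⟨ha0 ▸ cutPoint_mono hl (Nat.zero_le i) hi, hak ▸ cutPoint_mono hl hi le_rfl⟩
  have hsub : ∀ i < k, Icc (a i) (a i + l i) ⊆ Icc 0 1 := fun i hi => by
    rw [← hasucc]
    exact Icc_subset_Icc (ha01 i hi.le).1 (ha01 (i + 1) hi).2
  have hEL := fun i (hi : i < k) => exists_euler_lagrange (hu.closesUp i hi)
    fun w hw hw1 => norm_le_of_minimizer hu hmin hi hw hw1
  choose! v v₁ hvc hang hv hv₁ hvE using hEL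
  set θ := joinedAngle k l u with hθdef
  obtain ⟨M, hM⟩ : ∃ M, LipschitzWith M θ := by
    refine exists_lipschitzWith_joinedAngle hl fun i hi => ?_
    refine ContDiffOn.exists_lipschitzOnWith (n := 1) ?_ one_ne_zero (convex_Icc _ _) isCompact_Icc
    have := contDiffOn_succ_of_hasDerivWithinAt (n := 0) (uniqueDiffOn_Icc zero_lt_one) (hang i hi)
      (contDiffOn_zero.2 (hvc i hi).continuousOn)
    simpa using this
  have hθeq : ∀ i < k, ∀ t ∈ Icc (a i) (a i + l i), θ t =
      ∑ j ∈ Finset.range i, angle (u j) 1 + angle (u i) ((t - a i) / l i) :=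
    fun i hi t ht => joinedAngle_eq hl u hi ht
  have hθc : Continuous fun t => dir (θ t) := continuous_dir.comp hM.continuous
  have harc : ∀ i < k, ∫ t in a i..a (i + 1), dir (θ t) = 0 := fun i hi => by
    have e : ∫ t in a i..a i + l i, dir (θ t) = ∫ t in a i..a i + l i,
        (fun x => dir (∑ j ∈ Finset.range i, angle (u j) 1 + angle (u i) x)) ((t - a i) / l i) :=
      intervalIntegral.integral_congr fun t ht => by
        rw [uIcc_of_le (by linarith [hl i hi])] at ht
        simp only [hθeq i hi t ht]
    rw [hasucc]
    refine e.trans ((integral_rescale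
      (fun x => dir (∑ j ∈ Finset.range i, angle (u j) 1 + angle (u i) x)) _ (hl i hi)).trans ?_)
    rw [integral_dir_add_angle (hu.closesUp i hi), smul_zero]
  have hcut : ∀ i ≤ k, ∫ t in (0 : ℝ)..a i, dir (θ t) = 0 := fun i hi => by
    rw [← ha0, ← intervalIntegral.sum_integral_adjacent_intervals
      fun j _ => hθc.intervalIntegrable _ _]
    exact Finset.sum_eq_zero fun j hj => harc j ((Finset.mem_range.1 hj).trans_le hi)
  have hθ0 : θ 0 = 0 := by
    rw [hθeq 0 hk 0 ⟨ha0.le, by rw [ha0]; linarith [hl 0 hk]⟩, ha0]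
    simp
  have hθ1 : θ 1 = ∑ i ∈ Finset.range k, angle (u i) 1 := by
    obtain ⟨n, rfl⟩ : ∃ n, k = n + 1 := ⟨k - 1, by omega⟩
    have h1 : a n + l n = 1 := by rw [← hasucc, hak]
    have hln := hl n n.lt_succ_self
    rw [hθeq n n.lt_succ_self 1 ⟨by linarith, h1.ge⟩, Finset.sum_range_succ,
      show (1 : ℝ) - a n = l n by linarith, div_self hln.ne']
  have hdir01 : dir (θ 0) = dir (θ 1) := by
    have hc := hu.cos_turning
    have hs : Real.sin (∑ i ∈ Finset.range k, angle (u i) 1) = 0 := by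
      have := Real.sin_sq_add_cos_sq (∑ i ∈ Finset.range k, angle (u i) 1)
      rw [hc] at this
      exact pow_eq_zero_iff two_ne_zero |>.1 (by linarith)
    rw [hθ0, hθ1, dir, dir, hc, hs]
    simp
  obtain ⟨γ, hH2, hspeed, hγ', hγ⟩ := exists_closed_curve hM.lipschitzOnWith hdir01
    (by rw [← hak]; exact hcut k le_rfl)
  set c : ℕ → ℝ → ℝ := fun i t => v i ((t - a i) / l i) / l i with hcdef
  have hθ' : ∀ i < k, ∀ t ∈ Icc (a i) (a i + l i),
      HasDerivWithinAt θ (c i t) (Icc (a i) (a i + l i)) t := fun i hi t ht =>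
    ((hasDerivWithinAt_rescale (hang i hi) (a i) (hl i hi) t ht).const_add
      (∑ j ∈ Finset.range i, angle (u j) 1)).congr_of_mem (hθeq i hi) ht
  have hbend : ∀ i < k, IntervalIntegrable
        (fun t => ‖curvature univ (lift γ) t‖ ^ 2 * ‖deriv (lift γ) t‖) volume (a i) (a (i + 1)) ∧
      ∫ t in a i..a (i + 1), ‖curvature univ (lift γ) t‖ ^ 2 * ‖deriv (lift γ) t‖
        = S * ‖u i‖ := fun i hi => by
    have hli := hl i hi
    have hle : a i ≤ a i + l i := by linarith
    have hae : ∀ t ∈ Ioo (a i) (a i + l i),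
        ‖curvature univ (lift γ) t‖ ^ 2 * ‖deriv (lift γ) t‖ = c i t ^ 2 := fun t ht =>
      norm_curvature_of_angle ht hspeed (fun s hs => hγ' s (hsub i hi hs))
        ((hθ' i hi t ⟨ht.1.le, ht.2.le⟩).hasDerivAt (Icc_mem_nhds ht.1 ht.2))
    have hcc : Continuous fun t => c i t ^ 2 :=
      ((((hvc i hi).comp ((continuous_id.sub continuous_const).div_const _))).div_const _).pow 2
    rw [hasucc]
    constructor
    · refine (hcc.intervalIntegrable _ _).congr_ae ?_
      rw [uIoc_of_le hle, ← Measure.restrict_congr_set Ioo_ae_eq_Ioc, EventuallyEq,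
        ae_restrict_iff' measurableSet_Ioo]
      exact Eventually.of_forall fun t ht => (hae t ht).symm
    · have e : ∫ t in a i..a i + l i, ‖curvature univ (lift γ) t‖ ^ 2 * ‖deriv (lift γ) t‖
          = ∫ t in a i..a i + l i, (fun x => v i x ^ 2 / l i ^ 2) ((t - a i) / l i) := by
        rw [intervalIntegral.integral_of_le hle, intervalIntegral.integral_of_le hle,
          integral_Ioc_eq_integral_Ioo, integral_Ioc_eq_integral_Ioo]
        refine setIntegral_congr_fun measurableSet_Ioo fun t ht => ?_
        simp only [hae t ht, hcdef, div_pow]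
      refine e.trans ((integral_rescale (fun x => v i x ^ 2 / l i ^ 2) _ hli).trans ?_)
      rw [intervalIntegral.integral_div, hvE i hi, smul_eq_mul]
      have := hpos i hi
      -- What remains is `‖u i‖² / l i = S ‖u i‖`, which is the choice of `l i`.
      simp only [hldef]
      field_simp
  have hlen : length γ = 1 := by simp [length, hspeed]
  have hB : bending γ = S ^ 2 := by
    have h := intervalIntegral.sum_integral_adjacent_intervals (a := a) (n := k)
      fun i hi => (hbend i hi).1
    rw [ha0, hak] at h
    rw [bending, ← h, Finset.sum_congr rfl fun i hi => (hbend i (Finset.mem_range.1 hi)).2,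
      ← Finset.mul_sum, sq]
    rfl
  have himm : IsImmersed γ := fun t => by
    rw [← norm_ne_zero_iff, hspeed]; exact one_ne_zero
  have hp : ∀ i ≤ k, lift γ (a i) = 0 := fun i hi => by rw [hγ _ (ha01 i hi), hcut i hi]
  have halt : ∀ {i j}, i < j → j ≤ k → a i < a j := fun hij hj => cutPoint_lt hl hij hj
  have hmult : HasMultiplicity γ 0 k := by
    refine hasMultiplicity_of_injOn (a := a) (fun i hi => ⟨(ha01 i hi.le).1, ?_⟩) ?_
      fun i hi => hp i hi.le
    · rw [← hak]; exact halt hi le_rfl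
    · intro i hi j hj hij
      rcases lt_trichotomy i j with h | h | h
      · exact absurd hij (halt h (le_of_lt hj)).ne
      · exact h
      · exact absurd hij (halt h (le_of_lt hi)).ne'
  refine ⟨γ, ⟨hH2, himm, 0, hmult⟩, ?_, 0, hmult, a, fun i hi => halt i.lt_succ_self hi, ?_, hp,
    S ^ 2, by positivity, fun i hi => ?_⟩
  · rw [normalizedBending, hlen, hB, one_mul]
  · rw [ha0, hak, zero_add]
  · rw [hasucc]
    have hli := hl i hi
    refine isElastica_of_angle (by linarith)
      (fun t ht => (hγ' t (hsub i hi ht)).hasDerivWithinAt) (hθ' i hi)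
      (fun t ht => (hasDerivWithinAt_rescale (hv i hi) (a i) hli t ht).div_const (l i))
      (fun t ht => ?_)
    refine (((hasDerivWithinAt_rescale (hv₁ i hi) (a i) hli t ht).div_const (l i)).div_const
      (l i)).congr_deriv ?_
    have := hpos i hi
    simp only [hcdef, hldef]
    field_simp

/-! ### Arclength reparametrization of curvature densities -/

/-- A density `ρ` on `[a, b]` is transported by an increasing `C¹` change of variables
`s : [a, b] → [0, 1]` to an element of `L²(ℝ)` with the same primitive. -/
lemma exists_density {s s' ρ : ℝ → ℝ} {a b : ℝ} (hab : a < b) (hs : ∀ t, HasDerivAt s (s' t) t)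
    (hpos : ∀ t, 0 < s' t) (ha : s a = 0) (hb : s b = 1)
    (hρ : IntervalIntegrable ρ volume a b)
    (hρ2 : IntervalIntegrable (fun t => ρ t ^ 2 / s' t) volume a b) :
    ∃ u : L2Line, (∀ t ∈ Icc a b, angle u (s t) = ∫ x in a..t, ρ x) ∧
      ‖u‖ ^ 2 = ∫ t in a..b, ρ t ^ 2 / s' t := by
  have hmono : StrictMono s := strictMono_of_hasDerivAt_pos hs hpos
  have hcont : Continuous s := continuous_iff_continuousAt.2 fun t => (hs t).continuousAt
  have himage : ∀ t ∈ Icc a b, s '' Ioc a t = Ioc 0 (s t) := fun t ht => by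
    refine Subset.antisymm ?_ ?_
    · rintro _ ⟨x, hx, rfl⟩
      exact ⟨ha ▸ hmono hx.1, hmono.monotone hx.2⟩
    · rw [← ha]; exact intermediate_value_Ioc ht.1 hcont.continuousOn
  set τ := Function.invFun s
  have hτ : ∀ t, τ (s t) = t := Function.leftInverse_invFun hmono.injective
  set f : ℝ → ℝ := fun x => ρ (τ x) / s' (τ x) with hf
  have hfs : ∀ t, |s' t| • f (s t) = ρ t := fun t => by
    simp only [hf, hτ, abs_of_pos (hpos t), smul_eq_mul]
    field_simp [(hpos t).ne']
  have hf2s : ∀ t, |s' t| • f (s t) ^ 2 = ρ t ^ 2 / s' t := fun t => by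
    have := hpos t
    simp only [hf, hτ, abs_of_pos (hpos t), smul_eq_mul]
    field_simp
  have hd : ∀ S : Set ℝ, ∀ t ∈ S, HasDerivWithinAt s (s' t) S t := fun S t _ =>
    (hs t).hasDerivWithinAt
  have hab' : b ∈ Icc a b := right_mem_Icc.2 hab.le
  have hfint : IntegrableOn f (Ioc 0 1) := by
    rw [← hb, ← himage b hab', integrableOn_image_iff_integrableOn_abs_deriv_smul
      measurableSet_Ioc (hd _) hmono.injective.injOn]
    simp_rw [hfs]
    exact hρ.1
  have hf2int : IntegrableOn (fun x => f x ^ 2) (Ioc 0 1) := by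
    rw [← hb, ← himage b hab', integrableOn_image_iff_integrableOn_abs_deriv_smul
      measurableSet_Ioc (hd _) hmono.injective.injOn]
    simp_rw [hf2s]
    exact hρ2.1
  have hmem : MemLp ((Ioc (0 : ℝ) 1).indicator f) 2 volume := by
    rw [memLp_indicator_iff_restrict measurableSet_Ioc, memLp_two_iff_integrable_sq
      hfint.aestronglyMeasurable]
    exact hf2int
  have hcoe := hmem.coeFn_toLp
  refine ⟨hmem.toLp _, fun t ht => ?_, ?_⟩
  · have hst : s t ≤ 1 := hb ▸ hmono.monotone ht.2
    rw [angle_eq_setIntegral, setIntegral_congr_ae (g := f) measurableSet_Ioc]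
    · rw [← himage t ht, integral_image_eq_integral_abs_deriv_smul measurableSet_Ioc (hd _)
        hmono.injective.injOn]
      simp_rw [hfs]
      rw [intervalIntegral.integral_of_le ht.1]
    · filter_upwards [hcoe] with x hx hx'
      have hx1 : x ∈ Ioc (0 : ℝ) 1 := ⟨hx'.1, hx'.2.trans hst⟩
      rw [hx, indicator_of_mem hx1]
  · have e : ∀ᵐ x, inner ℝ (hmem.toLp _ x) (hmem.toLp _ x)
        = (Ioc (0 : ℝ) 1).indicator (fun x => f x ^ 2) x := by
      filter_upwards [hcoe] with x hx
      rw [hx]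
      by_cases h : x ∈ Ioc (0 : ℝ) 1
      · simp [h, sq]
      · simp [h]
    rw [← real_inner_self_eq_norm_sq, L2.inner_def, integral_congr_ae e,
      integral_indicator measurableSet_Ioc, ← hb, ← himage b hab',
      integral_image_eq_integral_abs_deriv_smul measurableSet_Ioc (hd _) hmono.injective.injOn]
    simp_rw [hf2s]
    rw [intervalIntegral.integral_of_le hab.le]

lemma integral_comp_change_of_variables {s s' ψ : ℝ → ℝ} {a b : ℝ}
    (hs : ∀ t, HasDerivAt s (s' t) t) (hs' : Continuous s') (ha : s a = 0) (hb : s b = 1)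
    (hψ : Continuous ψ) :
    ∫ x in (0 : ℝ)..1, ψ x = ∫ t in a..b, s' t * ψ (s t) := by
  rw [← ha, ← hb, ← intervalIntegral.integral_comp_mul_deriv (fun t _ => hs t)
    hs'.continuousOn hψ]
  exact intervalIntegral.integral_congr fun t _ => by simp [mul_comm]

end ElasticCurve

/-! ### The angle function of a curve with absolutely continuous velocity -/

lemma AbsolutelyContinuousOnInterval.comp_lipschitzOnWith {X Y : Type*} [PseudoMetricSpace X]
    [PseudoMetricSpace Y] {f : ℝ → X} {g : X → Y} {K : ℝ≥0} {a b : ℝ}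
    (hf : AbsolutelyContinuousOnInterval f a b) (hg : LipschitzOnWith K g (f '' uIcc a b)) :
    AbsolutelyContinuousOnInterval (fun t => g (f t)) a b := by
  rw [absolutelyContinuousOnInterval_iff] at hf ⊢
  intro ε hε
  obtain ⟨δ, hδ, h⟩ := hf (ε / (K + 1)) (by positivity)
  refine ⟨δ, hδ, fun E hE hEδ => ?_⟩
  have h1 := h E hE hEδ
  have h2 : ∑ i ∈ Finset.range E.1, dist (g (f (E.2 i).1)) (g (f (E.2 i).2))
      ≤ K * ∑ i ∈ Finset.range E.1, dist (f (E.2 i).1) (f (E.2 i).2) := by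
    rw [Finset.mul_sum]
    refine Finset.sum_le_sum fun i hi => ?_
    have := hE.1 i hi
    exact hg.dist_le_mul _ (mem_image_of_mem f this.1) _ (mem_image_of_mem f this.2)
  have h3 : 0 ≤ ∑ i ∈ Finset.range E.1, dist (f (E.2 i).1) (f (E.2 i).2) :=
    Finset.sum_nonneg fun _ _ => dist_nonneg
  rw [lt_div_iff₀ (by positivity)] at h1
  nlinarith

lemma AbsolutelyContinuousOnInterval.ofReal_add_I_mul {x y : ℝ → ℝ} {a b : ℝ}
    (hx : AbsolutelyContinuousOnInterval x a b) (hy : AbsolutelyContinuousOnInterval y a b) :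
    AbsolutelyContinuousOnInterval (fun t => (x t : ℂ) + Complex.I * y t) a b := by
  have h : ∀ {x : ℝ → ℝ}, AbsolutelyContinuousOnInterval x a b →
      AbsolutelyContinuousOnInterval (fun t => (x t : ℂ)) a b := fun hx =>
    hx.comp_lipschitzOnWith Complex.isometry_ofReal.lipschitz.lipschitzOnWith
  exact (h hx).add ((h hy).const_smul Complex.I)

lemma AbsolutelyContinuousOnInterval.cexp {f : ℝ → ℂ} {a b : ℝ}
    (hf : AbsolutelyContinuousOnInterval f a b) :
    AbsolutelyContinuousOnInterval (fun t => Complex.exp (f t)) a b := by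
  obtain ⟨C, hC⟩ := hf.exists_bound
  obtain ⟨K, hK⟩ := (Complex.contDiff_exp (n := 1) (𝕜 := ℝ)).contDiffOn.exists_lipschitzOnWith
    one_ne_zero (convex_closedBall (0 : ℂ) C) (isCompact_closedBall _ _)
  refine hf.comp_lipschitzOnWith (hK.mono ?_)
  rintro _ ⟨t, ht, rfl⟩
  exact mem_closedBall_zero_iff.2 (hC t ht)

/-- A nonvanishing absolutely continuous `z = x + i y` solves `z' = q' z` with `q' = z' / z`, hence
`z = z(a) exp q`; here `σ` and `ρ` are the real and imaginary parts of `z' / z`. -/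
lemma eq_mul_exp_of_absolutelyContinuous {x y σ ρ : ℝ → ℝ} {a b : ℝ} (hab : a ≤ b)
    (hx : AbsolutelyContinuousOnInterval x a b) (hy : AbsolutelyContinuousOnInterval y a b)
    (hσ : IntervalIntegrable σ volume a b) (hρ : IntervalIntegrable ρ volume a b)
    (hx' : ∀ t ∈ Icc a b, deriv x t = σ t * x t - ρ t * y t)
    (hy' : ∀ t ∈ Icc a b, deriv y t = ρ t * x t + σ t * y t) :
    ∀ t ∈ Icc a b, (x t : ℂ) + Complex.I * y t = (x a + Complex.I * y a) *
      Complex.exp ((∫ s in a..t, σ s : ℝ) + Complex.I * (∫ s in a..t, ρ s : ℝ)) := by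
  have ha : a ∈ uIcc a b := left_mem_uIcc
  set z : ℝ → ℂ := fun t => (x t : ℂ) + Complex.I * y t with hz
  set q : ℝ → ℂ := fun t => ((∫ s in a..t, σ s : ℝ) : ℂ) + Complex.I * (∫ s in a..t, ρ s : ℝ)
    with hq
  have hqac : AbsolutelyContinuousOnInterval q a b :=
    (hσ.absolutelyContinuousOnInterval_intervalIntegral ha).ofReal_add_I_mul
      (hρ.absolutelyContinuousOnInterval_intervalIntegral ha)
  have hFac : AbsolutelyContinuousOnInterval (fun t => z t • Complex.exp (-q t)) a b :=
    (hx.ofReal_add_I_mul hy).smul hqac.neg.cexp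
  have hFd : ∀ᵐ t, t ∈ uIcc a b → HasDerivAt (fun t => z t • Complex.exp (-q t)) 0 t := by
    filter_upwards [hx.ae_differentiableAt, hy.ae_differentiableAt, hσ.ae_hasDerivAt_integral,
      hρ.ae_hasDerivAt_integral] with t h1 h2 h3 h4 ht
    have ht' : t ∈ Icc a b := by rwa [uIcc_of_le hab] at ht
    have d1 := (h1 ht).hasDerivAt.ofReal_comp.add
      ((h2 ht).hasDerivAt.ofReal_comp.const_mul Complex.I)
    have d2 := (h3 ht a ha).ofReal_comp.add ((h4 ht a ha).ofReal_comp.const_mul Complex.I)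
    have d3 := d1.smul d2.neg.cexp
    refine d3.congr_deriv ?_
    simp only [hx' t ht', hy' t ht', smul_eq_mul, Pi.add_apply, Pi.neg_apply]
    push_cast
    ring_nf
    simp only [Complex.I_sq]
    ring
  obtain ⟨C, hC⟩ := hFac.const_of_ae_hasDerivAt_zero hFd
  intro t ht
  have h1 := hC t (by rwa [uIcc_of_le hab])
  have h2 := hC a ha
  have hqa : q a = 0 := by simp [hq]
  rw [hqa, neg_zero, Complex.exp_zero, smul_eq_mul, mul_one] at h2
  rw [smul_eq_mul, Complex.exp_neg] at h1
  show z t = z a * Complex.exp (q t)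
  rw [h2, ← h1, mul_assoc, inv_mul_cancel₀ (Complex.exp_ne_zero _), mul_one]

namespace ElasticCurve

/-- The velocity `(x, y)` has the angle `α + ∫ ρ`, where `ρ = (x y' - y x') / (x² + y²)`. -/
lemma exists_angle {x y : ℝ → ℝ} {a b : ℝ} (hab : a ≤ b)
    (hx : AbsolutelyContinuousOnInterval x a b) (hy : AbsolutelyContinuousOnInterval y a b)
    (hxc : Continuous x) (hyc : Continuous y) (hne : ∀ t, 0 < x t ^ 2 + y t ^ 2) {ρ : ℝ → ℝ}
    (hρ : ∀ t, ρ t = (x t * deriv y t - y t * deriv x t) / (x t ^ 2 + y t ^ 2)) :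
    IntervalIntegrable ρ volume a b ∧ ∃ α : ℝ, ∀ t ∈ Icc a b,
      x t = √(x t ^ 2 + y t ^ 2) * Real.cos (α + ∫ s in a..t, ρ s) ∧
      y t = √(x t ^ 2 + y t ^ 2) * Real.sin (α + ∫ s in a..t, ρ s) := by
  have hx' := hx.intervalIntegrable_deriv
  have hy' := hy.intervalIntegrable_deriv
  have hint : ∀ {f g : ℝ → ℝ}, Continuous f → Continuous g → IntervalIntegrable
      (fun t => f t / (x t ^ 2 + y t ^ 2) * deriv x t + g t / (x t ^ 2 + y t ^ 2) * deriv y t)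
      volume a b := by
    intro f g hf hg
    have h1 : Continuous fun t => f t / (x t ^ 2 + y t ^ 2) :=
      hf.div (by fun_prop) fun t => (hne t).ne'
    have h2 : Continuous fun t => g t / (x t ^ 2 + y t ^ 2) :=
      hg.div (by fun_prop) fun t => (hne t).ne'
    exact (hx'.continuousOn_mul h1.continuousOn).add (hy'.continuousOn_mul h2.continuousOn)
  have hρi : IntervalIntegrable ρ volume a b := by
    have := hint hyc.neg hxc
    refine this.congr fun t _ => ?_
    simp only [hρ, Pi.neg_apply]
    ring
  set σ : ℝ → ℝ := fun t => x t / (x t ^ 2 + y t ^ 2) * deriv x t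
    + y t / (x t ^ 2 + y t ^ 2) * deriv y t with hσ
  have hσi : IntervalIntegrable σ volume a b := hint hxc hyc
  have key := eq_mul_exp_of_absolutelyContinuous hab hx hy hσi hρi
    (fun t _ => by
      have := (hne t).ne'
      simp only [hρ, hσ]
      field_simp
      ring)
    (fun t _ => by
      have := (hne t).ne'
      simp only [hρ, hσ]
      field_simp
      ring)
  refine ⟨hρi, Complex.arg (x a + Complex.I * y a), fun t ht => ?_⟩
  set z₀ : ℂ := x a + Complex.I * y a
  set θ := ∫ s in a..t, ρ s
  set τ := ∫ s in a..t, σ s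
  have hz : (x t : ℂ) + Complex.I * y t =
      ((‖z₀‖ * Real.exp τ : ℝ) : ℂ) * Complex.exp ((z₀.arg + θ : ℝ) * Complex.I) := by
    rw [key t ht]
    conv_lhs => rw [← Complex.norm_mul_exp_arg_mul_I z₀]
    push_cast
    rw [mul_assoc, ← Complex.exp_add, mul_assoc, ← Complex.exp_add]
    congr 2
    ring
  have hn : ‖(x t : ℂ) + Complex.I * y t‖ = √(x t ^ 2 + y t ^ 2) := by
    rw [mul_comm, Complex.norm_add_mul_I]
  have hr : ‖z₀‖ * Real.exp τ = √(x t ^ 2 + y t ^ 2) := by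
    rw [← hn, hz, norm_mul, Complex.norm_exp_ofReal_mul_I, mul_one, Complex.norm_real,
      Real.norm_of_nonneg (by positivity)]
  rw [hr] at hz
  constructor
  · have := congrArg Complex.re hz
    rw [Complex.re_ofReal_mul, Complex.exp_ofReal_mul_I_re] at this
    simpa using this
  · have := congrArg Complex.im hz
    rw [Complex.im_ofReal_mul, Complex.exp_ofReal_mul_I_im] at this
    simpa using this

/-! ### The lower bound for curves in the class -/

lemma norm_eq_sqrt_coord (v : Plane) : ‖v‖ = √(v 0 ^ 2 + v 1 ^ 2) := by
  rw [EuclideanSpace.norm_eq, Fin.sum_univ_two, Real.norm_eq_abs, Real.norm_eq_abs, sq_abs, sq_abs]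

lemma plane_ext {v w : Plane} (h0 : v 0 = w 0) (h1 : v 1 = w 1) : v = w := by
  ext i
  fin_cases i
  · exact h0
  · exact h1

lemma hasDerivAt_coord {f : ℝ → Plane} {f' : Plane} {t : ℝ} (hf : HasDerivAt f f' t) (j : Fin 2) :
    HasDerivAt (fun t => f t j) (f' j) t :=
  (EuclideanSpace.proj j : Plane →L[ℝ] ℝ).hasFDerivAt.comp_hasDerivAt t hf

/-- The coordinates of the velocity are absolutely continuous on `[a, b]`, with square integrable
derivatives. -/
structure HasH2Velocity (g : ℝ → Plane) (a b : ℝ) : Prop where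
  absCont : ∀ j, AbsolutelyContinuousOnInterval (fun t => deriv g t j) a b
  sq_integrable : ∀ j, IntervalIntegrable (fun t => deriv (fun t => deriv g t j) t ^ 2) volume a b

/-- A closed arc, not necessarily with matching tangents at its end points, yields a curvature
density in arclength, whose squared `L²` norm is the product of length and bending energy. -/
lemma exists_density_of_arc {g : ℝ → Plane} (hg : ContDiff ℝ 1 g) (himm : ∀ t, deriv g t ≠ 0)
    {a b : ℝ} (hab : a < b) (hH2 : HasH2Velocity g a b) (hclosed : g a = g b) :
    ∃ u : L2Line, ∃ α : ℝ, ClosesUp u ∧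
      IntervalIntegrable (fun t => ‖curvature univ g t‖ ^ 2 * ‖deriv g t‖) volume a b ∧
      ‖u‖ ^ 2 = (∫ t in a..b, ‖deriv g t‖) *
        ∫ t in a..b, ‖curvature univ g t‖ ^ 2 * ‖deriv g t‖ ∧
      tangent univ g a = dir α ∧ tangent univ g b = dir (α + angle u 1) := by
  have hgc : Continuous (deriv g) := hg.continuous_deriv le_rfl
  set x : ℝ → ℝ := fun t => deriv g t 0 with hxdef
  set y : ℝ → ℝ := fun t => deriv g t 1 with hydef
  set r : ℝ → ℝ := fun t => ‖deriv g t‖ with hrdef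
  have hxc : Continuous x := by fun_prop
  have hyc : Continuous y := by fun_prop
  have hrc : Continuous r := hgc.norm
  have hr0 : ∀ t, 0 < r t := fun t => norm_pos_iff.2 (himm t)
  have hrsq : ∀ t, √(x t ^ 2 + y t ^ 2) = r t := fun t => (norm_eq_sqrt_coord _).symm
  have hr2 : ∀ t, x t ^ 2 + y t ^ 2 = r t ^ 2 := fun t => by
    rw [← hrsq, Real.sq_sqrt (by positivity)]
  set ρ : ℝ → ℝ := fun t => (x t * deriv y t - y t * deriv x t) / (x t ^ 2 + y t ^ 2) with hρdef
  obtain ⟨hρ, α, hα⟩ := exists_angle hab.le (hH2.absCont 0) (hH2.absCont 1) hxc hyc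
    (fun t => by rw [hr2]; exact pow_pos (hr0 t) 2) (ρ := ρ) fun _ => rfl
  set θ : ℝ → ℝ := fun t => ∫ s in a..t, ρ s with hθdef
  have hvel : ∀ t ∈ Icc a b, deriv g t = r t • dir (α + θ t) := fun t ht => by
    have h := hα t ht
    rw [hrsq] at h
    refine plane_ext ?_ ?_
    · rw [PiLp.smul_apply, dir_apply_zero]; exact h.1
    · rw [PiLp.smul_apply, dir_apply_one]; exact h.2
  have htan : ∀ t ∈ Icc a b, tangent univ g t = dir (α + θ t) := fun t ht => by
    rw [tangent, arcDeriv, derivWithin_univ]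
    conv_lhs => rw [hvel t ht]
    rw [norm_smul, norm_dir, mul_one, Real.norm_of_nonneg (hr0 t).le, smul_smul,
      inv_mul_cancel₀ (hr0 t).ne', one_smul]
  have hcurv : ∀ᵐ t, t ∈ Ioc a b → ‖curvature univ g t‖ ^ 2 * ‖deriv g t‖ = ρ t ^ 2 / r t := by
    have hb : ∀ᵐ t : ℝ, t ≠ b := by simp [ae_iff, measure_singleton]
    filter_upwards [hρ.ae_hasDerivAt_integral, hb] with t ht htb htab
    have htI : t ∈ Ioo a b := ⟨htab.1, lt_of_le_of_ne htab.2 htb⟩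
    have hθ : HasDerivAt (fun t => α + θ t) (ρ t) t :=
      (ht (by rw [uIcc_of_le hab.le]; exact Ioo_subset_Icc_self htI) a left_mem_uIcc).const_add α
    have he : tangent univ g =ᶠ[𝓝 t] fun t => dir (α + θ t) := by
      filter_upwards [Icc_mem_nhds htI.1 htI.2] with s hs using htan s hs
    have hd : HasDerivAt (tangent univ g) (ρ t • dirNormal (α + θ t)) t :=
      ((hasDerivAt_dir _).scomp t hθ).congr_of_eventuallyEq he
    have hrt : ‖deriv g t‖ = r t := rfl
    have := (hr0 t).ne'
    rw [curvature, arcDeriv, derivWithin_univ, derivWithin_univ, hd.deriv, norm_smul, norm_smul,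
      norm_dirNormal, norm_inv, norm_norm, hrt, mul_one, Real.norm_eq_abs, mul_pow, sq_abs]
    field_simp
  -- Since `ρ = Im (z' / z)` for `z = x + i y`, it is bounded by `|z'| / |z|`.
  have hρ2 : IntervalIntegrable (fun t => ρ t ^ 2 / r t) volume a b := by
    have hbound : IntervalIntegrable (fun t => (r t ^ 3)⁻¹ * (deriv x t ^ 2 + deriv y t ^ 2))
        volume a b :=
      ((hH2.sq_integrable 0).add (hH2.sq_integrable 1)).continuousOn_mul
        ((hrc.pow 3).inv₀ fun t => (pow_pos (hr0 t) 3).ne').continuousOn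
    refine hbound.mono_fun ?_ (Eventually.of_forall fun t => ?_)
    · have h := (intervalIntegrable_iff.1 hρ).aestronglyMeasurable.aemeasurable.pow_const 2
      exact (h.div hrc.measurable.aemeasurable).aestronglyMeasurable
    · have hrt := hr0 t
      show ‖ρ t ^ 2 / r t‖ ≤ ‖(r t ^ 3)⁻¹ * (deriv x t ^ 2 + deriv y t ^ 2)‖
      rw [Real.norm_of_nonneg (by positivity), Real.norm_of_nonneg (by positivity)]
      simp only [hρdef, hr2]
      rw [div_pow, div_div, inv_mul_eq_div, div_le_div_iff₀ (by positivity) (by positivity)]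
      have hcs : (x t * deriv y t - y t * deriv x t) ^ 2
          ≤ r t ^ 2 * (deriv x t ^ 2 + deriv y t ^ 2) := by
        rw [← hr2]; nlinarith [sq_nonneg (x t * deriv x t + y t * deriv y t)]
      calc _ ≤ r t ^ 2 * (deriv x t ^ 2 + deriv y t ^ 2) * r t ^ 3 := by gcongr
        _ = _ := by ring
  have hB : ∫ t in a..b, ‖curvature univ g t‖ ^ 2 * ‖deriv g t‖ = ∫ t in a..b, ρ t ^ 2 / r t := by
    refine intervalIntegral.integral_congr_ae ?_
    rw [uIoc_of_le hab.le]
    exact hcurv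
  have hBint : IntervalIntegrable (fun t => ‖curvature univ g t‖ ^ 2 * ‖deriv g t‖) volume a b := by
    refine hρ2.congr_ae ?_
    rw [uIoc_of_le hab.le, EventuallyEq, ae_restrict_iff' measurableSet_Ioc]
    filter_upwards [hcurv] with t ht hts using (ht hts).symm
  set ℓ := ∫ t in a..b, r t with hℓdef
  have hℓ : 0 < ℓ :=
    intervalIntegral.intervalIntegral_pos_of_pos (hrc.intervalIntegrable _ _) hr0 hab
  set s : ℝ → ℝ := fun t => (∫ τ in a..t, r τ) / ℓ with hsdef
  have hs : ∀ t, HasDerivAt s (r t / ℓ) t := fun t =>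
    (intervalIntegral.integral_hasDerivAt_right (hrc.intervalIntegrable _ _)
      (hrc.stronglyMeasurableAtFilter _ _) hrc.continuousAt).div_const ℓ
  have hsa : s a = 0 := by simp [hsdef]
  have hsb : s b = 1 := div_self hℓ.ne'
  have hρ2' : ∀ t, ρ t ^ 2 / (r t / ℓ) = ℓ * (ρ t ^ 2 / r t) := fun t => by
    have := (hr0 t).ne'
    field_simp
  obtain ⟨u, hu, hunorm⟩ := exists_density hab hs (fun t => div_pos (hr0 t) hℓ) hsa hsb hρ
    (by simp_rw [hρ2']; exact hρ2.const_mul ℓ)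
  have hθc : ContinuousOn θ (Icc a b) := by
    have := (hρ.absolutelyContinuousOnInterval_intervalIntegral left_mem_uIcc).continuousOn
    rwa [uIcc_of_le hab.le] at this
  have hcoord : ∀ j, ∫ t in a..b, deriv g t j = 0 := fun j => by
    have hd : ∀ t ∈ uIcc a b, HasDerivAt (fun t => g t j) (deriv g t j) t := fun t _ =>
      hasDerivAt_coord ((hg.differentiable one_ne_zero) t).hasDerivAt j
    rw [intervalIntegral.integral_eq_sub_of_hasDerivAt hd
      (Continuous.intervalIntegrable (by fun_prop) _ _), hclosed, sub_self]
  have hx0 : ∫ t in a..b, r t * Real.cos (α + θ t) = 0 := by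
    rw [← hcoord 0]
    refine intervalIntegral.integral_congr fun t ht => ?_
    rw [uIcc_of_le hab.le] at ht
    simp only [hvel t ht, PiLp.smul_apply, dir_apply_zero, smul_eq_mul]
  have hy0 : ∫ t in a..b, r t * Real.sin (α + θ t) = 0 := by
    rw [← hcoord 1]
    refine intervalIntegral.integral_congr fun t ht => ?_
    rw [uIcc_of_le hab.le] at ht
    simp only [hvel t ht, PiLp.smul_apply, dir_apply_one, smul_eq_mul]
  -- The closing conditions are invariant under rotations, so the initial angle `α` drops out.
  have hrot : ∀ p q : ℝ,
      ∫ t in a..b, (p * (r t * Real.cos (α + θ t)) + q * (r t * Real.sin (α + θ t))) = 0 := by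
    intro p q
    have hi : ∀ {f : ℝ → ℝ}, Continuous f →
        IntervalIntegrable (fun t => r t * f (α + θ t)) volume a b := fun hf => by
      refine ContinuousOn.intervalIntegrable ?_
      rw [uIcc_of_le hab.le]
      exact hrc.continuousOn.mul (hf.comp_continuousOn (continuousOn_const.add hθc))
    rw [intervalIntegral.integral_add ((hi Real.continuous_cos).const_mul p)
      ((hi Real.continuous_sin).const_mul q), intervalIntegral.integral_const_mul,
      intervalIntegral.integral_const_mul, hx0, hy0]
    simp
  have hclose : ClosesUp u := by
    constructor
    · rw [integral_comp_change_of_variables hs (hrc.div_const ℓ) hsa hsb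
        (ψ := fun x => Real.cos (angle u x)) (by fun_prop),
        ← hrot (Real.cos α / ℓ) (Real.sin α / ℓ)]
      refine intervalIntegral.integral_congr fun t ht => ?_
      rw [uIcc_of_le hab.le] at ht
      have e : Real.cos (θ t) =
          Real.cos α * Real.cos (α + θ t) + Real.sin α * Real.sin (α + θ t) := by
        rw [← Real.cos_sub, ← Real.cos_neg]; congr 1; ring
      simp only [hu t ht]
      change r t / ℓ * Real.cos (θ t) = _
      rw [e]; ring
    · rw [integral_comp_change_of_variables hs (hrc.div_const ℓ) hsa hsb
        (ψ := fun x => Real.sin (angle u x)) (by fun_prop),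
        ← hrot (-Real.sin α / ℓ) (Real.cos α / ℓ)]
      refine intervalIntegral.integral_congr fun t ht => ?_
      rw [uIcc_of_le hab.le] at ht
      have e : Real.sin (θ t) =
          Real.sin (α + θ t) * Real.cos α - Real.cos (α + θ t) * Real.sin α := by
        rw [← Real.sin_sub]; congr 1; ring
      simp only [hu t ht]
      change r t / ℓ * Real.sin (θ t) = _
      rw [e]; ring
  have hab' : b ∈ Icc a b := right_mem_Icc.2 hab.le
  refine ⟨u, α, hclose, hBint, ?_, ?_, ?_⟩
  · rw [hunorm, hB]
    simp_rw [hρ2']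
    rw [intervalIntegral.integral_const_mul]
  · rw [htan a (left_mem_Icc.2 hab.le)]
    simp [hθdef]
  · rw [htan b hab', ← hsb, hu b hab']

lemma periodic_lift {E : Type*} (γ : UnitAddCircle → E) : Function.Periodic (lift γ) 1 :=
  fun t => by simp [lift]

lemma periodic_deriv {F : Type*} [NormedAddCommGroup F] [NormedSpace ℝ F] {f : ℝ → F}
    (hf : Function.Periodic f 1) : Function.Periodic (deriv f) 1 := fun t => by
  rw [← deriv_comp_add_const, show (fun x => f (x + 1)) = f from funext hf]

/-- Absolute continuity over one period of a periodic function passes to all intervals. -/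
lemma absolutelyContinuousOnInterval_of_periodic {f : ℝ → ℝ} (hf : Function.Periodic f 1)
    (h : AbsolutelyContinuousOnInterval f 0 1) (a b : ℝ) :
    AbsolutelyContinuousOnInterval f a b := by
  have hf' : Function.Periodic (deriv f) 1 := periodic_deriv hf
  have hint : ∀ a b, IntervalIntegrable (deriv f) volume a b :=
    hf'.intervalIntegrable₀ one_ne_zero h.intervalIntegrable_deriv
  set F : ℝ → ℝ := fun t => f t - ∫ s in (0 : ℝ)..t, deriv f s with hF
  have hFp : Function.Periodic F 1 := fun t => by
    have e : ∫ s in t..t + 1, deriv f s = 0 := by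
      rw [hf'.intervalIntegral_add_eq t 0, zero_add, h.integral_deriv_eq_sub, ← zero_add (1 : ℝ),
        hf 0, sub_self]
    simp only [hF]
    rw [hf t, ← intervalIntegral.integral_add_adjacent_intervals (hint 0 t) (hint t (t + 1)), e,
      add_zero]
  have hF0 : ∀ t, F t = f 0 := fun t => by
    obtain ⟨s, hs, hst⟩ := hFp.exists_mem_Ico₀ one_pos t
    have hs' : uIcc 0 s ⊆ uIcc (0 : ℝ) 1 := by
      rw [uIcc_of_le hs.1, uIcc_of_le zero_le_one]
      exact Icc_subset_Icc_right hs.2.le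
    rw [hst]
    simp only [hF]
    rw [(h.mono hs').integral_deriv_eq_sub]
    ring
  -- `f` is a constant plus the primitive of a locally integrable function.
  have hfeq : f = fun t => f 0 + ∫ s in (0 : ℝ)..t, deriv f s := funext fun t => by
    rw [← hF0 t]; simp [hF]
  rw [hfeq]
  have hle : min 0 (min a b) ≤ max 0 (max a b) := (min_le_left _ _).trans (le_max_left _ _)
  have hab : uIcc a b ⊆ uIcc (min 0 (min a b)) (max 0 (max a b)) := by
    rw [uIcc_of_le hle]
    exact Icc_subset_Icc (min_le_right _ _) (le_max_right _ _)
  refine AbsolutelyContinuousOnInterval.mono ?_ hab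
  refine AbsolutelyContinuousOnInterval.add ?_
    ((hint _ _).absolutelyContinuousOnInterval_intervalIntegral ?_)
  · exact (LipschitzWith.const (f 0)).lipschitzOnWith.absolutelyContinuousOnInterval
  · rw [uIcc_of_le hle]
    exact ⟨min_le_left _ _, le_max_left _ _⟩

lemma IsH2.hasH2Velocity {γ : UnitAddCircle → Plane} (hγ : IsH2 γ) (a b : ℝ) :
    HasH2Velocity (lift γ) a b := by
  set G := deriv (lift γ) with hG
  have hGp : Function.Periodic G 1 := periodic_deriv (periodic_lift γ)
  have hcp : ∀ j, Function.Periodic (fun t => G t j) 1 := fun j t => by simp only [hGp t]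
  have hac : ∀ j, AbsolutelyContinuousOnInterval (fun t => G t j) 0 1 := fun j =>
    hγ.absCont.comp_lipschitzOnWith (g := fun v : Plane => v j)
      (LipschitzWith.lipschitzOnWith (K := ‖(EuclideanSpace.proj j : Plane →L[ℝ] ℝ)‖₊)
        (EuclideanSpace.proj j : Plane →L[ℝ] ℝ).lipschitz)
  refine ⟨fun j => absolutelyContinuousOnInterval_of_periodic (hcp j) (hac j) a b, fun j => ?_⟩
  have hp : Function.Periodic (fun t => deriv (fun t => G t j) t ^ 2) 1 := fun t => by
    simp only [periodic_deriv (hcp j) t]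
  refine hp.intervalIntegrable₀ one_ne_zero ?_ a b
  have hmem : MemLp (fun t => (deriv G t) j) 2 (volume.restrict (Icc (0 : ℝ) 1)) :=
    (EuclideanSpace.proj j : Plane →L[ℝ] ℝ).comp_memLp' hγ.memLp
  have hsq : IntegrableOn (fun t => (deriv G t) j ^ 2) (Icc (0 : ℝ) 1) := hmem.integrable_sq
  rw [intervalIntegrable_iff_integrableOn_Icc_of_le zero_le_one]
  refine hsq.congr_fun_ae ?_
  rw [EventuallyEq, ae_restrict_iff' measurableSet_Icc]
  filter_upwards [(hac 0).ae_differentiableAt, (hac 1).ae_differentiableAt] with t h0 h1 ht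
  rw [← uIcc_of_le (zero_le_one' ℝ)] at ht
  have hd : DifferentiableAt ℝ G t := by
    rw [differentiableAt_euclidean]
    intro i
    fin_cases i
    · exact h0 ht
    · exact h1 ht
  rw [(hasDerivAt_coord hd.hasDerivAt j).deriv]

lemma dir_add_eq_of_dir_eq {α β : ℝ} (h : dir α = dir β) (φ : ℝ) : dir (α + φ) = dir (β + φ) := by
  have hc : Real.cos α = Real.cos β := by rw [← dir_apply_zero, h, dir_apply_zero]
  have hs : Real.sin α = Real.sin β := by rw [← dir_apply_one, h, dir_apply_one]
  rw [dir, dir, Real.cos_add, Real.cos_add, Real.sin_add, Real.sin_add, hc, hs]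

lemma cos_eq_one_of_dir_add_eq {α φ : ℝ} (h : dir (α + φ) = dir α) : Real.cos φ = 1 := by
  have hc : Real.cos (α + φ) = Real.cos α := by rw [← dir_apply_zero, h, dir_apply_zero]
  have hs : Real.sin (α + φ) = Real.sin α := by rw [← dir_apply_one, h, dir_apply_one]
  have e : Real.cos φ = Real.cos (α + φ - α) := by congr 1; ring
  rw [e, Real.cos_sub, hc, hs, ← sq, ← sq, Real.cos_sq_add_sin_sq]

/-- `k` preimages of a point cut the circle into `k` parameter intervals. -/
lemma HasMultiplicity.exists_cuts {γ : UnitAddCircle → Plane} {p : Plane} {k : ℕ} (hk : 1 ≤ k)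
    (h : HasMultiplicity γ p k) :
    ∃ t : ℕ → ℝ, (∀ i < k, t i < t (i + 1)) ∧ t k = t 0 + 1 ∧ ∀ i ≤ k, lift γ (t i) = p := by
  obtain ⟨s, hs, hsk⟩ := exists_subset_encard_eq h
  have hfin : s.Finite := finite_of_encard_eq_coe hsk
  set A : Set ℝ := (fun x => ((AddCircle.equivIco 1 0 x : Ico (0 : ℝ) (0 + 1)) : ℝ)) '' s with hA
  have hAfin : A.Finite := hfin.image _
  have hinj : Function.Injective
      fun x : UnitAddCircle => ((AddCircle.equivIco 1 0 x : Ico (0 : ℝ) (0 + 1)) : ℝ) :=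
    Subtype.val_injective.comp (AddCircle.equivIco 1 0).injective
  have hcard : hAfin.toFinset.card = k := by
    have : A.encard = k := by rw [hA, hinj.injOn.encard_image, hsk]
    rw [hAfin.encard_eq_coe_toFinset_card] at this
    exact_mod_cast this
  set e := hAfin.toFinset.orderEmbOfFin hcard with he
  have heA : ∀ i, e i ∈ A := fun i => by
    have := Finset.orderEmbOfFin_mem hAfin.toFinset hcard i
    exact hAfin.mem_toFinset.1 this
  have heI : ∀ i, e i ∈ Ico (0 : ℝ) 1 := fun i => by
    obtain ⟨x, -, hx⟩ := heA i
    rw [← hx]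
    simpa using (AddCircle.equivIco 1 0 x).2
  have hep : ∀ i, lift γ (e i) = p := fun i => by
    obtain ⟨x, hxs, hx⟩ := heA i
    rw [← hx, lift]
    have : (((AddCircle.equivIco 1 0 x : Ico (0 : ℝ) (0 + 1)) : ℝ) : UnitAddCircle) = x :=
      AddCircle.coe_equivIco
    rw [this]
    exact hs hxs
  refine ⟨fun n => if h : n < k then e ⟨n, h⟩ else e ⟨0, hk⟩ + 1, fun i hi => ?_, ?_, fun i _ => ?_⟩
  · by_cases h1 : i + 1 < k
    · simp only [hi, h1, dif_pos]
      exact e.strictMono (by simp [Fin.lt_def])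
    · simp only [hi, h1, dif_pos, dif_neg, not_false_eq_true]
      linarith [(heI ⟨i, hi⟩).2, (heI ⟨0, hk⟩).1]
  · have h0 : 0 < k := hk
    simp [h0]
  · by_cases h1 : i < k
    · simp only [h1, dif_pos]; exact hep _
    · simp only [h1, dif_neg, not_false_eq_true]
      rw [periodic_lift γ]
      exact hep _

/-- The arcs of a curve in the class give an admissible family; the inequality is the
Cauchy–Schwarz inequality for the lengths and the bending energies of the arcs. -/
theorem exists_admissible_of_mem_curveClass {k : ℕ} (hk : 1 ≤ k) {γ : UnitAddCircle → Plane}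
    (hγ : γ ∈ curveClass k) : ∃ u, Admissible k u ∧ normSum k u ^ 2 ≤ normalizedBending γ := by
  obtain ⟨hH2, himm, p, hp⟩ := hγ
  obtain ⟨t, htlt, htk, htp⟩ := hp.exists_cuts hk
  set G := deriv (lift γ) with hG
  have hGp : Function.Periodic G 1 := periodic_deriv (periodic_lift γ)
  have hGc : Continuous G := hH2.contDiff.continuous_deriv le_rfl
  have hTp : Function.Periodic (tangent univ (lift γ)) 1 := fun s => by
    simp only [tangent, arcDeriv, derivWithin_univ]
    rw [← hG, hGp s]
  have hBp : Function.Periodic (fun s => ‖curvature univ (lift γ) s‖ ^ 2 * ‖G s‖) 1 := fun s => by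
    simp only [curvature, arcDeriv, derivWithin_univ]
    rw [← hG, hGp s, periodic_deriv hTp s]
  have harc := fun i (hi : i < k) => exists_density_of_arc hH2.contDiff himm (htlt i hi)
    (hH2.hasH2Velocity (t i) (t (i + 1))) ((htp i hi.le).trans (htp (i + 1) hi).symm)
  choose! u α hclose hint hnorm hTa hTb using harc
  have hturn : ∀ n ≤ k, tangent univ (lift γ) (t n)
      = dir (α 0 + ∑ i ∈ Finset.range n, angle (u i) 1) := by
    intro n
    induction n with
    | zero => intro _; simpa using hTa 0 hk
    | succ n ih =>
      intro hn
      rw [hTb n hn, Finset.sum_range_succ, ← add_assoc]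
      exact dir_add_eq_of_dir_eq ((hTa n hn).symm.trans (ih (by omega))) _
  refine ⟨u, ⟨hclose, cos_eq_one_of_dir_add_eq (α := α 0) ?_⟩, ?_⟩
  · rw [← hturn k le_rfl, htk, hTp, hTa 0 hk]
  · set l : ℕ → ℝ := fun i => ∫ s in t i..t (i + 1), ‖G s‖ with hl
    set B : ℕ → ℝ := fun i => ∫ s in t i..t (i + 1), ‖curvature univ (lift γ) s‖ ^ 2 * ‖G s‖ with hB
    have hl0 : ∀ i ∈ Finset.range k, 0 ≤ l i := fun i hi =>
      intervalIntegral.integral_nonneg (htlt i (Finset.mem_range.1 hi)).le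
        fun s _ => norm_nonneg _
    have hB0 : ∀ i ∈ Finset.range k, 0 ≤ B i := fun i hi =>
      intervalIntegral.integral_nonneg (htlt i (Finset.mem_range.1 hi)).le
        fun s _ => by positivity
    have hL : length γ = ∑ i ∈ Finset.range k, l i := by
      rw [hl, intervalIntegral.sum_integral_adjacent_intervals
        fun i _ => hGc.norm.intervalIntegrable _ _, htk, length]
      have hp' : Function.Periodic (fun s => ‖G s‖) 1 := fun s => by simp only [hGp s]
      rw [hp'.intervalIntegral_add_eq (t 0) 0, zero_add]
    have hBs : bending γ = ∑ i ∈ Finset.range k, B i := by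
      rw [hB, intervalIntegral.sum_integral_adjacent_intervals fun i hi => hint i hi, htk, bending,
        hBp.intervalIntegral_add_eq (t 0) 0, zero_add]
    have hn : normSum k u = ∑ i ∈ Finset.range k, √(l i) * √(B i) := by
      refine Finset.sum_congr rfl fun i hi => ?_
      rw [← Real.sqrt_mul (hl0 i hi), ← hnorm i (Finset.mem_range.1 hi),
        Real.sqrt_sq (norm_nonneg _)]
    rw [hn, normalizedBending, hL, hBs]
    refine (Finset.sum_mul_sq_le_sq_mul_sq _ _ _).trans (le_of_eq ?_)
    congr 1
    · exact Finset.sum_congr rfl fun i hi => Real.sq_sqrt (hl0 i hi)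
    · exact Finset.sum_congr rfl fun i hi => Real.sq_sqrt (hB0 i hi)

end ElasticCurve
end

theorem mainTheorem9 (k : ℕ) (hk : 1 ≤ k) :
    ∃ γ ∈ ElasticCurve.curveClass k,
      ElasticCurve.normalizedBending γ = ElasticCurve.beta k ∧
      ∃ p : EuclideanSpace ℝ (Fin 2), ElasticCurve.HasMultiplicity γ p k ∧
        ∃ a : Fin (k + 1) → ℝ, StrictMono a ∧ a (Fin.last k) = a 0 + 1 ∧
          (∀ i, γ (a i : UnitAddCircle) = p) ∧
          ∃ lam : ℝ, 0 < lam ∧ ∀ i : Fin k,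
            ElasticCurve.IsElastica (ElasticCurve.lift γ) (a i.castSucc) (a i.succ) lam := by
  obtain ⟨u, hu, hmin⟩ := ElasticCurve.exists_minimizer k
  obtain ⟨γ, hγ, hE, p, hp, a, ha, hak, hap, lam, hlam, hel⟩ :=
    ElasticCurve.exists_curve_of_minimizer hk hu hmin
  have hleast : IsLeast (ElasticCurve.normalizedBending '' ElasticCurve.curveClass k)
      (ElasticCurve.normalizedBending γ) := by
    refine ⟨⟨γ, hγ, rfl⟩, ?_⟩
    rintro _ ⟨γ', hγ', rfl⟩
    obtain ⟨w, hw, hle⟩ := ElasticCurve.exists_admissible_of_mem_curveClass hk hγ'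
    rw [hE]
    exact (pow_le_pow_left₀ (ElasticCurve.normSum_nonneg k u) (hmin w hw) 2).trans hle
  refine ⟨γ, hγ, hleast.csInf_eq.symm, p, hp, fun i => a i, ?_, by simpa using hak,
    fun i => hap i (Nat.lt_succ_iff.1 i.2), lam, hlam, fun i => ?_⟩
  · exact Fin.strictMono_iff_lt_succ.2 fun i => by simpa using ha i i.2
  · simpa using hel i i.2
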